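/- **Setting.** Let $\mathcal X$, $\mathcal Z$ be measurable spaces, $\mu$ a $\sigma$-finite reference measure on $\mathcal Z$ (written $dz$), $Q_X$ a probability distribution on $\mathcal X$, $P_Z$ a distribution on $\mathcal Z$ with density $p(z)$, and $Q_{Z|x}$ ($x\in\mathcal X$) distributions on $\mathcal Z$ with jointly measurable density $q(z|x)$; assume $Q_{Z|x}\ll P_Z$ for $Q_X$-almost every $x$. For a convex $f:(0,\infty)\to\mathbb R$ with $f(1)=0$, extended to $0$ by $f(0)=\lim_{t\downarrow0}f(t)\in(-\infty,\infty]$, let $D_f(Q\|P_Z)=\int f\bigl(q(z)/p(z)\bigr)p(z)\,dz\in[0,\infty]$ for a distribution $Q\ll P_Z$ with density $q$. For $\mathbf X^N=(X_1,\dots,X_N)$ i.i.d. from $Q_X$ let $\hat Q_Z^N=\frac1N\sum_{i=1}^N Q_{Z|X_i}$, with density $\hat q_N$; the RAM estimator is $D_f(\hat Q_Z^N\|P_Z)$. Given $\mathbf X^N$, let $\mathbf Z^M=(Z_1,\dots,Z_M)$ be i.i.d. from a proposal density $\pi(z|\mathbf X^N)$ (jointly measurable in $z$ and $\mathbf X^N$);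 the RAM-MC estimator is $$\hat D_f^M(\hat Q_Z^N\|P_Z)=\frac1M\sum_{m=1}^M f\!\left(\frac{\hat q_N(Z_m)}{p(Z_m)}\right)\frac{p(Z_m)}{\pi(Z_m|\mathbf X^N)} .$$ **Theorem.** (a) For every such $f$, all $N,M\ge1$ and any proposal $\pi$ such that, for almost every $\mathbf X^N$, $\pi(z|\mathbf X^N)>0$ at $P_Z$-almost every $z$ with $f(\hat q_N(z)/p(z))\neq0$, $$\mathbb E_{\mathbf Z^M,\mathbf X^N}\bigl[\hat D_f^M(\hat Q_Z^N\|P_Z)\bigr]=\mathbb E_{\mathbf X^N}\bigl[D_f(\hat Q_Z^N\|P_Z)\bigr],$$ where both expectations are well defined in $(-\infty,\infty]$. (b) Let $f(t)=f_0(t)+c(t-1)$ with $c\in\mathbb R$ and $f_0$, $\psi(N)$ from one of the following rows: | divergence | $f_0(t)$ | $\psi(N)$ | |---|---|---| | KL | $t\log t-t+1$ | $N^{-1/6}\log N$ | | total variation | $\frac12\lvert1-t\rvert$ | $N^{-1/2}$ | | $\chi^2$ | $(t-1)^2$ | $N^{-1/2}$ | | Jensen–Shannon | $(1+t)\log\frac{2}{1+t}+t\log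 t$ | $N^{-1/6}\log N$ | | $f_\beta$, $\frac12<\beta<1$ | $\frac{1}{1-1/\beta}\bigl[(1+t^\beta)^{1/\beta}-2^{1/\beta-1}(1+t)\bigr]$ | $N^{-1/6}$ | | $f_\beta$, $1<\beta<\infty$ | same formula | $N^{-1/2}$ | | $f_\alpha$, $\frac13<\alpha<1$ | $\frac{4}{1-\alpha^2}\bigl(1-t^{(1+\alpha)/2}\bigr)-\frac{2(t-1)}{\alpha-1}$ | $N^{(1-3\alpha)/(\alpha+5)}$ | Suppose that either (i) $\pi(z|\mathbf X^N)=p(z)$, $\ \mathbb E_X\bigl\|f\bigl(\tfrac{q(z|X)}{p(z)}\bigr)\bigr\|^2_{L_2(P_Z)}<\infty$ and $\mathbb E_X\bigl\|\tfrac{q(z|X)}{p(z)}\bigr\|^2_{L_2(P_Z)}<\infty$; or (ii) $\pi(z|\mathbf X^N)=\hat q_N(z)$, for $Q_X$-almost every $x$ one has $q(z|x)>0$ for $P_Z$-almost every $z$, $\ \mathbb E_X\bigl\|f\bigl(\tfrac{q(z|X)}{p(z)}\bigr)\tfrac{p(z)}{q(z|X)}\bigr\|^2_{L_2(Q_{Z|X})}<\infty$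 and $\mathbb E_X\bigl\|\tfrac{p(z)}{q(z|X)}\bigr\|^2_{L_2(Q_{Z|X})}<\infty$. Then $\hat D_f^M(\hat Q_Z^N\|P_Z)$ is square-integrable for all $N\ge2$, $M\ge1$, and $$\operatorname{Var}_{\mathbf Z^M,\mathbf X^N}\bigl[\hat D_f^M(\hat Q_Z^N\|P_Z)\bigr]=O(M^{-1})+O(\psi(N)^2),$$ that is, the variance is at most $K\bigl(M^{-1}+\psi(N)^2\bigr)$ for all $N\ge2$, $M\ge1$, with a constant $K$ that does not depend on $N$ or $M$. -/

import Mathlib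

open MeasureTheory ProbabilityTheory Set Filter Topology
open scoped ENNReal

noncomputable section

namespace RAM

/-- `p` is a probability density with respect to the reference measure `μ`. -/
structure IsDensity {Z : Type*} [MeasurableSpace Z] (μ : Measure Z) (p : Z → ℝ) : Prop where
  measurable : Measurable p
  nonneg : ∀ z, 0 ≤ p z
  lintegral_eq_one : ∫⁻ z, ENNReal.ofReal (p z) ∂μ = 1

/-- The distribution with density `p` with respect to `μ`. -/
def law {Z : Type*} [MeasurableSpace Z] (μ : Measure Z) (p : Z → ℝ) : Measure Z :=
  μ.withDensity fun z => ENNReal.ofReal (p z)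

/-- Integral of the positive part of an extended-real function. -/
def posPart {Ω : Type*} [MeasurableSpace Ω] (m : Measure Ω) (g : Ω → EReal) : ℝ≥0∞ :=
  ∫⁻ w, (g w).toENNReal ∂m

/-- Integral of the negative part of an extended-real function. -/
def negPart {Ω : Type*} [MeasurableSpace Ω] (m : Measure Ω) (g : Ω → EReal) : ℝ≥0∞ :=
  ∫⁻ w, (-g w).toENNReal ∂m

/-- Expectation of an extended-real function, meaningful when `negPart m g` is finite;
its value may then be `⊤`. -/
def expect {Ω : Type*} [MeasurableSpace Ω] (m : Measure Ω) (g : Ω → EReal) : EReal :=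
  (posPart m g : EReal) - (negPart m g : EReal)

/-- A function `f` on `(0, ∞)`, extended to `0` by its limit there. For convex `f` the limit exists
and lies in `(-∞, ∞]`. -/
def extendZero (f : ℝ → ℝ) (t : ℝ) : EReal :=
  if 0 < t then (f t : EReal) else liminf (fun s : ℝ => (f s : EReal)) (𝓝[>] 0)

/-- The `f`-divergence `∫ f (q / p) p dμ` of the distributions with densities `q` and `p`. -/
def fDiv {Z : Type*} [MeasurableSpace Z] (f : ℝ → ℝ) (μ : Measure Z) (q p : Z → ℝ) : EReal :=
  expect (law μ p) fun z => extendZero f (q z / p z)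

/-- The density of the mixture `(1 / N) ∑ᵢ Q_{Z|xᵢ}`, where `q x` is the density of `Q_{Z|x}`. -/
def mixture {X Z : Type*} (q : X → Z → ℝ) {N : ℕ} (x : Fin N → X) (z : Z) : ℝ :=
  (1 / (N : ℝ)) * ∑ i, q (x i) z

/-- The law of an i.i.d. sample of size `N` from `ν`. -/
abbrev sampleLaw {X : Type*} [MeasurableSpace X] (ν : Measure X) (N : ℕ) : Measure (Fin N → X) :=
  Measure.pi fun _ => ν

/-- The joint law of `(X₁, …, X_N, Z₁, …, Z_M)`, where the `Xᵢ` are i.i.d. from `ν` and, given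
`x = (X₁, …, X_N)`, the `Z_m` are i.i.d. with density `pr x` with respect to `μ`. -/
def jointLaw {X Z : Type*} [MeasurableSpace X] [MeasurableSpace Z] (ν : Measure X) (μ : Measure Z)
    {N : ℕ} (pr : (Fin N → X) → Z → ℝ) (M : ℕ) : Measure ((Fin N → X) × (Fin M → Z)) :=
  ((sampleLaw ν N).prod (Measure.pi fun _ => μ)).withDensity
    fun w => ∏ m, ENNReal.ofReal (pr w.1 (w.2 m))

/-- The random mixture estimator. -/
def ram {X Z : Type*} [MeasurableSpace Z] (f : ℝ → ℝ) (μ : Measure Z) (p : Z → ℝ) (q : X → Z → ℝ)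
    {N : ℕ} (x : Fin N → X) : EReal :=
  fDiv f μ (mixture q x) p

/-- The importance-sampled Monte-Carlo estimator, with proposal density `pr x`. -/
def ramMC {X Z : Type*} (f : ℝ → ℝ) (p : Z → ℝ) (q : X → Z → ℝ)
    {N : ℕ} (pr : (Fin N → X) → Z → ℝ) {M : ℕ} (w : (Fin N → X) × (Fin M → Z)) : EReal :=
  ((1 / (M : ℝ) : ℝ) : EReal) *
    ∑ m, extendZero f (mixture q w.1 (w.2 m) / p (w.2 m)) *
      ((p (w.2 m) / pr w.1 (w.2 m) : ℝ) : EReal)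

/-- `pr` is an admissible proposal for the integrand given by `f`: a measurable family of densities
such that, for almost every sample, `pr` is positive wherever the integrand does not vanish. -/
structure IsProposal {X Z : Type*} [MeasurableSpace X] [MeasurableSpace Z] (f : ℝ → ℝ)
    (ν : Measure X) (μ : Measure Z) (p : Z → ℝ) (q : X → Z → ℝ)
    {N : ℕ} (pr : (Fin N → X) → Z → ℝ) : Prop where
  measurable : Measurable (Function.uncurry pr)
  isDensity : ∀ x, IsDensity μ (pr x)
  pos : ∀ᵐ x ∂(sampleLaw ν N), ∀ᵐ z ∂(law μ p),
    extendZero f (mixture q x z / p z) ≠ 0 → 0 < pr x z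

/-- The divergences for which a concentration rate is given. -/
inductive Divergence where
  | kl
  | tv
  | chiSq
  | js
  | fBeta (β : ℝ)
  | fAlpha (α : ℝ)

namespace Divergence

/-- The parameter ranges. -/
def Admissible : Divergence → Prop
  | kl => True
  | tv => True
  | chiSq => True
  | js => True
  | fBeta β => 1 / 2 < β ∧ β ≠ 1
  | fAlpha α => 1 / 3 < α ∧ α < 1

/-- The normalised generator. -/
def f₀ : Divergence → ℝ → ℝ
  | kl, t => t * Real.log t - t + 1
  | tv, t => 1 / 2 * |1 - t|
  | chiSq, t => (t - 1) ^ 2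
  | js, t => (1 + t) * Real.log (2 / (1 + t)) + t * Real.log t
  | fBeta β, t =>
      1 / (1 - 1 / β) * ((1 + t ^ β) ^ (1 / β) - (2 : ℝ) ^ (1 / β - 1) * (1 + t))
  | fAlpha α, t =>
      4 / (1 - α ^ 2) * (1 - t ^ ((1 + α) / 2)) - 2 * (t - 1) / (α - 1)

/-- The generators of the divergence, which differ by multiples of `t - 1`. -/
def gen (D : Divergence) (c : ℝ) (t : ℝ) : ℝ := D.f₀ t + c * (t - 1)

/-- The concentration rate `ψ(N)`. -/
def rate : Divergence → ℕ → ℝ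
  | kl, N => (N : ℝ) ^ (-(1 / 6) : ℝ) * Real.log N
  | tv, N => (N : ℝ) ^ (-(1 / 2) : ℝ)
  | chiSq, N => (N : ℝ) ^ (-(1 / 2) : ℝ)
  | js, N => (N : ℝ) ^ (-(1 / 6) : ℝ) * Real.log N
  | fBeta β, N => if β < 1 then (N : ℝ) ^ (-(1 / 6) : ℝ) else (N : ℝ) ^ (-(1 / 2) : ℝ)
  | fAlpha α, N => (N : ℝ) ^ ((1 - 3 * α) / (α + 5))

end Divergence

/-- The moment conditions for the proposal `p`. -/
structure PriorMoments {X Z : Type*} [MeasurableSpace X] [MeasurableSpace Z] (f : ℝ → ℝ)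
    (ν : Measure X) (μ : Measure Z) (p : Z → ℝ) (q : X → Z → ℝ) : Prop where
  gen_ratio : ∫⁻ x, eLpNorm (fun z => f (q x z / p z)) 2 (law μ p) ^ 2 ∂ν < ⊤
  ratio : ∫⁻ x, eLpNorm (fun z => q x z / p z) 2 (law μ p) ^ 2 ∂ν < ⊤

/-- The moment conditions for the proposal `q̂_N`. The density `q x` must be positive almost
everywhere for the distribution with density `p`, that is, `p / q x` is finite there. -/
structure MixtureMoments {X Z : Type*} [MeasurableSpace X] [MeasurableSpace Z] (f : ℝ → ℝ)
    (ν : Measure X) (μ : Measure Z) (p : Z → ℝ) (q : X → Z → ℝ) : Prop where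
  pos : ∀ᵐ x ∂ν, ∀ᵐ z ∂(law μ p), 0 < q x z
  gen_ratio :
    ∫⁻ x, eLpNorm (fun z => f (q x z / p z) * (p z / q x z)) 2 (law μ (q x)) ^ 2 ∂ν < ⊤
  ratio : ∫⁻ x, eLpNorm (fun z => p z / q x z) 2 (law μ (q x)) ^ 2 ∂ν < ⊤

/-- The estimator with proposal `pr N` on samples of size `N` is square-integrable with variance
`O(1 / M) + O(ψ(N)²)`; the constant does not depend on `N` or `M`. -/
def VarianceBound {X Z : Type*} [MeasurableSpace X] [MeasurableSpace Z] (f : ℝ → ℝ) (ψ : ℕ → ℝ)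
    (ν : Measure X) (μ : Measure Z) (p : Z → ℝ) (q : X → Z → ℝ)
    (pr : (N : ℕ) → (Fin N → X) → Z → ℝ) : Prop :=
  ∃ K : ℝ, ∀ N M : ℕ, 2 ≤ N → 1 ≤ M →
    MemLp (fun w => (ramMC f p q (pr N) w).toReal) 2 (jointLaw ν μ (pr N) M) ∧
    variance (fun w => (ramMC f p q (pr N) w).toReal) (jointLaw ν μ (pr N) M)
      ≤ K * (1 / (M : ℝ) + ψ N ^ 2)

end RAM

end

/-! Part (a) is a change of measure. An infinite positive part is allowed, so extended-real
integrals are carried as pairs of `ℝ≥0∞` integrals. A supporting line of `f` at 1 with slope `a`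
bounds the negative part of `f t` by `|a| * (1 + t)`, and the likelihood ratio has integral at most
one under the prior. The negative parts are therefore integrable, and Tonelli together with
`lintegral_importance` treats both parts separately.

Part (b) rests on one stronger fact: the variance is `O(1/M) + O(1/N)` for every row of the table.
All the rates ψ decay no faster than a constant times `N ^ (-1/2)`, so 1/N is `O(ψ(N)²)`
(`Divergence.inv_le_mul_rate_sq`). Conditioning on the outer sample (`variance_average_le`) splits
off a Monte-Carlo error, at most 1/M times a second moment, and leaves the variance of the
conditional mean, which is the RAM estimator ∫ f(t) dP, where t is the average of the ratios `s (x
i)` and P is the prior.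

The Efron–Stein inequality handles this variance: delete the i-th component without renormalising,
so that t drops by `h = s (x i) / N`. The increment bound gives |f(t) - f(t - h)| ≤ h √W with W = C
(1 + t² + f(t)²) / (t + t²). Cauchy–Schwarz under the probability measure with P-density `s (x i)`
bounds the i-th squared effect by N⁻² ∫ `s (x i)` W dP. Since the `s (x i)` sum to N t, the total is
at most (C / N) ∫ (1 + t² + f(t)²) / (1 + t) dP. Thus f only needs control of its increments
relative to its own growth, which is checked for each generator.

Both proposals have the form (r₀ + r₁ t) P, with (r₀, r₁) = (1, 0) for the prior and (0, 1) for the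
mixture. The integral of (1 + t² + f(t)²) / (r₀ + r₁ t) dominates the Monte-Carlo second moment as
well as the Efron–Stein sum, and by convexity (`exists_growth_div_average_le`) it is controlled,
uniformly in N, by the same quantity for a single component. For a single component its finiteness
follows from the moment hypothesis. -/

namespace RAM

/-! ### Extended-real expectations as differences of `ℝ≥0∞` integrals. -/

section ExtendedExpectation

variable {Ω : Type*} [MeasurableSpace Ω]

/-- Positive part minus negative part recovers `a - b`; adding across avoids subtracting infinities
and makes the identity integrable term by term. -/
theorem ereal_coe_sub_toENNReal_add (a b : ℝ≥0∞) (hb : b ≠ ⊤) :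
    ((a : EReal) - b).toENNReal + b = (-((a : EReal) - b)).toENNReal + a := by
  lift b to NNReal using hb
  induction a with
  | top => simp
  | coe a =>
    have h : ((((a : NNReal) : ℝ≥0∞) : EReal) - (((b : NNReal) : ℝ≥0∞) : EReal))
        = (((a : ℝ) - (b : ℝ) : ℝ) : EReal) := rfl
    rw [h, ← EReal.coe_neg, EReal.real_coe_toENNReal, EReal.real_coe_toENNReal,
      ← ENNReal.ofReal_coe_nnreal, ← ENNReal.ofReal_coe_nnreal]
    rcases le_total (a : ℝ) b with hab | hab
    · rw [ENNReal.ofReal_of_nonpos (sub_nonpos.2 hab), zero_add,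
        ← ENNReal.ofReal_add (by linarith) a.coe_nonneg]
      congr 1; ring
    · rw [ENNReal.ofReal_of_nonpos (p := -((a : ℝ) - b)) (by linarith), zero_add,
        ← ENNReal.ofReal_add (by linarith) b.coe_nonneg]
      congr 1; ring

theorem toENNReal_neg_coe_sub_le (a b : ℝ≥0∞) : (-((a : EReal) - b)).toENNReal ≤ b := by
  induction b with
  | top => exact le_top
  | coe b =>
    rw [EReal.neg_sub (Or.inr (EReal.coe_ennreal_ne_bot _)) (Or.inr (by simp))]
    refine (EReal.toENNReal_le_toENNReal (y := ((b : ℝ≥0∞) : EReal)) ?_).trans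
      (by rw [EReal.toENNReal_coe])
    rw [add_comm, ← sub_eq_add_neg]
    exact EReal.sub_le_of_le_add (le_add_of_nonneg_right (EReal.coe_ennreal_nonneg a))

theorem ennreal_coe_sub_eq_of_add_eq {p n a b : ℝ≥0∞} (hn : n ≠ ⊤) (hb : b ≠ ⊤)
    (h : p + b = n + a) : (p : EReal) - n = (a : EReal) - b := by
  lift n to NNReal using hn
  lift b to NNReal using hb
  induction a with
  | top =>
    have : p = ⊤ := by simpa using h
    subst this
    simp
  | coe a =>
    have hp : p ≠ ⊤ := by rintro rfl; simp [← ENNReal.coe_add] at h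
    lift p to NNReal using hp
    have h' : (p : ℝ) + b = n + a := by exact_mod_cast h
    have e : ∀ u v : NNReal, (((u : ℝ≥0∞) : EReal) - ((v : ℝ≥0∞) : EReal))
        = (((u : ℝ) - (v : ℝ) : ℝ) : EReal) := fun _ _ => rfl
    rw [e, e]
    congr 1
    linarith

/-- The expectation of a difference of `ℝ≥0∞`-valued functions. -/
theorem expect_eq_of_eq_sub (m : Measure Ω) {g : Ω → EReal} {A B : Ω → ℝ≥0∞}
    (hA : Measurable A) (hB : Measurable B) (hBf : ∫⁻ w, B w ∂m ≠ ⊤)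
    (hg : ∀ w, g w = (A w : EReal) - B w) :
    negPart m g ≠ ⊤ ∧ expect m g = ((∫⁻ w, A w ∂m : ℝ≥0∞) : EReal) - (∫⁻ w, B w ∂m : ℝ≥0∞) := by
  have hn : negPart m g ≠ ⊤ := by
    refine ne_top_of_le_ne_top hBf (lintegral_mono fun w => ?_)
    rw [hg]
    exact toENNReal_neg_coe_sub_le _ _
  refine ⟨hn, ennreal_coe_sub_eq_of_add_eq hn hBf ?_⟩
  -- The decomposition `A - B` need not be the Jordan one. The pointwise cross-added identity, valid
  -- where `B` is finite, transfers it to the positive and negative parts after integration.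
  rw [posPart, negPart, ← lintegral_add_right _ hB, ← lintegral_add_right _ hA]
  refine lintegral_congr_ae ?_
  filter_upwards [ae_lt_top hB hBf] with w hw
  rw [hg]
  exact ereal_coe_sub_toENNReal_add _ _ hw.ne

theorem coe_toENNReal_sub_coe_toENNReal_neg (x : EReal) :
    (x.toENNReal : EReal) - ((-x).toENNReal : EReal) = x := by
  rcases le_total 0 x with h | h
  · rw [EReal.coe_toENNReal h, EReal.toENNReal_of_nonpos (x := -x) (by simpa using h)]
    simp
  · rw [EReal.toENNReal_of_nonpos h, EReal.coe_toENNReal (by simpa using h)]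
    simp

theorem sum_coe_sub_coe {ι : Type*} (s : Finset ι) (a b : ι → ℝ≥0∞) (hb : ∀ i ∈ s, b i ≠ ⊤) :
    ∑ i ∈ s, ((a i : EReal) - (b i : EReal))
      = ((∑ i ∈ s, a i : ℝ≥0∞) : EReal) - ((∑ i ∈ s, b i : ℝ≥0∞) : EReal) := by
  classical
  induction s using Finset.induction_on with
  | empty => simp
  | insert i s hi ih =>
    rw [Finset.sum_insert hi, Finset.sum_insert hi, Finset.sum_insert hi,
      ih fun j hj => hb j (Finset.mem_insert_of_mem hj), EReal.coe_ennreal_add,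
      EReal.coe_ennreal_add, EReal.add_sub_add_comm]
    · exact Or.inl (EReal.coe_ennreal_ne_bot _)
    · exact Or.inr (EReal.coe_ennreal_ne_bot _)

end ExtendedExpectation

/-! ### The joint law as an iterated integral. -/

section JointLaw

variable {X Z : Type*} [MeasurableSpace X] [MeasurableSpace Z]

theorem lintegral_pi_fin_prod (n : ℕ) (μ : Measure Z) [SigmaFinite μ] (g : Fin n → Z → ℝ≥0∞)
    (hg : ∀ i, Measurable (g i)) :
    ∫⁻ z, ∏ i, g i (z i) ∂(Measure.pi fun _ : Fin n => μ) = ∏ i, ∫⁻ z, g i z ∂μ := by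
  induction n with
  | zero => simp
  | succ n ih =>
    have hmp := (measurePreserving_piFinSuccAbove (fun _ : Fin (n + 1) => μ) 0).symm
    rw [← hmp.lintegral_comp_emb (MeasurableEquiv.measurableEmbedding _), lintegral_prod]
    · simp only [Fin.prod_univ_succ]
      have : ∀ a : Z, ∀ b : Fin n → Z,
          (MeasurableEquiv.piFinSuccAbove (fun _ : Fin (n + 1) => Z) 0).symm (a, b)
            = Fin.cons a b := by
        intro a b
        simp [MeasurableEquiv.piFinSuccAbove, Fin.insertNthEquiv]
      simp only [this, Fin.cons_zero, Fin.cons_succ]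
      have h2 : ∀ a, ∫⁻ b : Fin n → Z, g 0 a * ∏ i, g (Fin.succ i) (b i)
          ∂(Measure.pi fun _ : Fin n => μ) = g 0 a * ∏ i, ∫⁻ z, g (Fin.succ i) z ∂μ := by
        intro a
        rw [lintegral_const_mul _ (by fun_prop), ih _ fun i => hg _]
      rw [lintegral_congr h2, lintegral_mul_const _ (hg 0)]
    · have : Measurable fun z : Fin (n + 1) → Z => ∏ i, g i (z i) := by fun_prop
      exact (this.comp (MeasurableEquiv.measurable _)).aemeasurable

/-- Both measures agree on boxes, where the indicator and the density factor over the coordinates.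
This identifies the inner part of `jointLaw` with an i.i.d. sample. -/
theorem pi_withDensity_prod (n : ℕ) (μ : Measure Z) [SigmaFinite μ] (d : Z → ℝ≥0∞)
    (hd : Measurable d) [SigmaFinite (μ.withDensity d)] :
    (Measure.pi fun _ : Fin n => μ).withDensity (fun z => ∏ i, d (z i))
      = Measure.pi fun _ : Fin n => μ.withDensity d := by
  refine (Measure.pi_eq fun s hs => ?_).symm
  rw [withDensity_apply _ (MeasurableSet.univ_pi hs),
    ← lintegral_indicator (MeasurableSet.univ_pi hs)]
  have h : ∀ z : Fin n → Z, (univ.pi s).indicator (fun z => ∏ i, d (z i)) z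
      = ∏ i, (s i).indicator d (z i) := by
    intro z
    by_cases hz : z ∈ univ.pi s
    · rw [indicator_of_mem hz]
      exact Finset.prod_congr rfl fun i _ => (indicator_of_mem (hz i trivial) _).symm
    · rw [indicator_of_notMem hz]
      simp only [Set.mem_pi, mem_univ, true_imp_iff, not_forall] at hz
      obtain ⟨i, hi⟩ := hz
      exact (Finset.prod_eq_zero (Finset.mem_univ i) (indicator_of_notMem hi _)).symm
  rw [lintegral_congr h, lintegral_pi_fin_prod n μ _ fun i => hd.indicator (hs i)]
  refine Finset.prod_congr rfl fun i _ => ?_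
  rw [lintegral_indicator (hs i), withDensity_apply _ (hs i)]

theorem IsDensity.isProbabilityMeasure_law {μ : Measure Z} {p : Z → ℝ} (hp : IsDensity μ p) :
    IsProbabilityMeasure (law μ p) :=
  ⟨by rw [law, withDensity_apply _ MeasurableSet.univ, Measure.restrict_univ]
      exact hp.lintegral_eq_one⟩

/-- Integration against the joint law, first over the inner sample and then over the outer one. -/
theorem lintegral_jointLaw (ν : Measure X) [IsProbabilityMeasure ν] (μ : Measure Z) [SigmaFinite μ]
    {N M : ℕ} {pr : (Fin N → X) → Z → ℝ} (hm : Measurable (Function.uncurry pr))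
    (hd : ∀ x, IsDensity μ (pr x)) {F : (Fin N → X) × (Fin M → Z) → ℝ≥0∞} (hF : Measurable F) :
    ∫⁻ w, F w ∂(jointLaw ν μ pr M)
      = ∫⁻ x, ∫⁻ z, F (x, z) ∂(Measure.pi fun _ : Fin M => law μ (pr x)) ∂(sampleLaw ν N) := by
  have hdm : Measurable fun w : (Fin N → X) × (Fin M → Z) =>
      ∏ m, ENNReal.ofReal (pr w.1 (w.2 m)) := by
    refine Finset.measurable_prod _ fun m _ => ENNReal.measurable_ofReal.comp ?_
    exact hm.comp (f := fun w : (Fin N → X) × (Fin M → Z) => (w.1, w.2 m)) (by fun_prop)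
  rw [jointLaw, lintegral_withDensity_eq_lintegral_mul _ hdm hF,
    lintegral_prod _ (hdm.mul hF).aemeasurable]
  refine lintegral_congr fun x => ?_
  have := (hd x).isProbabilityMeasure_law
  have hdx : Measurable fun z => ENNReal.ofReal (pr x z) := (hd x).measurable.ennreal_ofReal
  have : SigmaFinite (μ.withDensity fun z => ENNReal.ofReal (pr x z)) :=
    inferInstanceAs (SigmaFinite (law μ (pr x)))
  rw [show (Measure.pi fun _ : Fin M => law μ (pr x)) = _ from
      (pi_withDensity_prod M μ _ hdx).symm,
    lintegral_withDensity_eq_lintegral_mul _ (by fun_prop) (by fun_prop)]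
  rfl

theorem isProbabilityMeasure_jointLaw (ν : Measure X) [IsProbabilityMeasure ν] (μ : Measure Z)
    [SigmaFinite μ] {N M : ℕ} {pr : (Fin N → X) → Z → ℝ} (hm : Measurable (Function.uncurry pr))
    (hd : ∀ x, IsDensity μ (pr x)) : IsProbabilityMeasure (jointLaw ν μ pr M) := by
  constructor
  have := fun x => (hd x).isProbabilityMeasure_law
  rw [← lintegral_one, lintegral_jointLaw ν μ hm hd measurable_const]
  simp

end JointLaw

/-! ### Supporting lines and the extension of `f` to zero. -/

theorem exists_supporting_line {f : ℝ → ℝ} (hf : ConvexOn ℝ (Ioi 0) f) (h1 : f 1 = 0) :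
    ∃ a : ℝ, ∀ t, 0 < t → a * (t - 1) ≤ f t := by
  have hint : (1 : ℝ) ∈ interior (Ioi (0 : ℝ)) := by simp
  -- The right derivative at 1 serves on both sides, since the left derivative does not exceed it.
  refine ⟨derivWithin f (Ioi 1) 1, fun t ht => ?_⟩
  rcases lt_trichotomy t 1 with h | h | h
  · have hs := (hf.slope_le_leftDeriv_of_mem_interior (mem_Ioi.2 ht) hint h).trans
      (hf.leftDeriv_le_rightDeriv_of_mem_interior hint)
    rw [slope_def_field, h1, div_le_iff₀ (by linarith)] at hs
    linarith
  · simp [h, h1]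
  · have hs := hf.rightDeriv_le_slope_of_mem_interior hint (mem_Ioi.2 ht) h
    rw [slope_def_field, h1, le_div_iff₀ (by linarith)] at hs
    linarith

theorem measurable_extendZero {f : ℝ → ℝ} (hf : ContinuousOn f (Ioi 0)) :
    Measurable (extendZero f) := by
  have h : extendZero f = (Ioi (0 : ℝ)).piecewise (fun t => ((f t : ℝ) : EReal))
      (fun _ => liminf (fun s : ℝ => (f s : EReal)) (𝓝[>] 0)) := by
    funext t
    simp [extendZero, Set.piecewise]
  rw [h]
  exact (continuous_coe_real_ereal.comp_continuousOn hf).measurable_piecewise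
    continuousOn_const measurableSet_Ioi

theorem le_extendZero {f : ℝ → ℝ} {a : ℝ} (ha : ∀ t, 0 < t → a * (t - 1) ≤ f t) {t : ℝ}
    (ht : 0 ≤ t) : ((a * (t - 1) : ℝ) : EReal) ≤ extendZero f t := by
  unfold extendZero
  split_ifs with h
  · exact EReal.coe_le_coe (ha t h)
  · obtain rfl : t = 0 := le_antisymm (not_lt.1 h) ht
    have hlim : Tendsto (fun s : ℝ => ((a * (s - 1) : ℝ) : EReal)) (𝓝[>] 0)
        (𝓝 ((a * (0 - 1) : ℝ) : EReal)) := by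
      refine Tendsto.mono_left (Continuous.tendsto ?_ 0) nhdsWithin_le_nhds
      exact continuous_coe_real_ereal.comp (by fun_prop)
    rw [← hlim.liminf_eq]
    refine liminf_le_liminf ?_
    filter_upwards [self_mem_nhdsWithin] with s hs
    exact EReal.coe_le_coe (ha s hs)

theorem toENNReal_neg_extendZero_le {f : ℝ → ℝ} {a : ℝ} (ha : ∀ t, 0 < t → a * (t - 1) ≤ f t)
    {t : ℝ} (ht : 0 ≤ t) : (-extendZero f t).toENNReal ≤ ENNReal.ofReal (|a| * (1 + t)) := by
  rw [← EReal.real_coe_toENNReal]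
  refine EReal.toENNReal_le_toENNReal ?_
  rw [EReal.neg_le]
  refine le_trans ?_ (le_extendZero ha ht)
  rw [← EReal.coe_neg]
  refine EReal.coe_le_coe ?_
  have h1 : |a * (t - 1)| ≤ |a| * (1 + t) := by
    rw [abs_mul]
    refine mul_le_mul_of_nonneg_left ?_ (abs_nonneg a)
    rw [abs_le]
    constructor <;> linarith
  linarith [neg_le_of_abs_le h1]

/-! ### Unbiasedness of importance sampling. -/

section Unbiased

variable {X Z : Type*} [MeasurableSpace X] [MeasurableSpace Z]

theorem isDensity_mixture {X Z : Type*} [MeasurableSpace Z] {μ : Measure Z} {q : X → Z → ℝ} (hqd : ∀ x, IsDensity μ (q x))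
    {N : ℕ} (hN : 1 ≤ N) (x : Fin N → X) : IsDensity μ (mixture q x) := by
  have hN0 : (0 : ℝ) < N := by exact_mod_cast hN
  have hm : ∀ i, Measurable (q (x i)) := fun i => (hqd (x i)).measurable
  refine ⟨?_, fun z => ?_, ?_⟩
  · unfold mixture
    fun_prop
  · exact mul_nonneg (by positivity) (Finset.sum_nonneg fun i _ => (hqd (x i)).nonneg z)
  · have h : ∀ z, ENNReal.ofReal (mixture q x z)
        = ENNReal.ofReal (1 / (N : ℝ)) * ∑ i, ENNReal.ofReal (q (x i) z) := by
      intro z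
      rw [mixture, ENNReal.ofReal_mul (by positivity),
        ENNReal.ofReal_sum_of_nonneg fun i _ => (hqd (x i)).nonneg z]
    rw [lintegral_congr h, lintegral_const_mul _ (by fun_prop),
      lintegral_finsetSum _ (fun i _ => by fun_prop)]
    simp only [(hqd _).lintegral_eq_one, Finset.sum_const, Finset.card_univ, Fintype.card_fin,
      nsmul_eq_mul, mul_one]
    rw [← ENNReal.ofReal_natCast, ← ENNReal.ofReal_mul (by positivity),
      one_div_mul_cancel hN0.ne', ENNReal.ofReal_one]

theorem measurable_mixture {q : X → Z → ℝ} (hq : Measurable (Function.uncurry q)) (N : ℕ) :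
    Measurable (Function.uncurry fun (x : Fin N → X) z => mixture q x z) := by
  have h : ∀ i : Fin N, Measurable fun w : (Fin N → X) × Z => q (w.1 i) w.2 := fun i =>
    hq.comp (f := fun w : (Fin N → X) × Z => (w.1 i, w.2)) (by fun_prop)
  simp only [Function.uncurry_def, mixture]
  fun_prop

theorem lintegral_law {μ : Measure Z} {p : Z → ℝ} (hp : Measurable p) {G : Z → ℝ≥0∞}
    (hG : Measurable G) : ∫⁻ z, G z ∂(law μ p) = ∫⁻ z, ENNReal.ofReal (p z) * G z ∂μ := by
  rw [law, lintegral_withDensity_eq_lintegral_mul _ hp.ennreal_ofReal hG]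
  rfl

/-- Only an inequality holds: no absolute continuity is assumed, and mass of `r` on `p = 0` is lost.
-/
theorem lintegral_ratio_le {μ : Measure Z} {p r : Z → ℝ} (hp : IsDensity μ p)
    (hr : IsDensity μ r) : ∫⁻ z, ENNReal.ofReal (r z / p z) ∂(law μ p) ≤ 1 := by
  have hpm := hp.measurable
  have hrm := hr.measurable
  rw [lintegral_law hpm (by fun_prop), ← hr.lintegral_eq_one]
  refine lintegral_mono fun z => ?_
  rw [← ENNReal.ofReal_mul (hp.nonneg z)]
  refine ENNReal.ofReal_le_ofReal ?_
  rcases (hp.nonneg z).eq_or_lt' with h | h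
  · simp [h, hr.nonneg z]
  · rw [mul_div_cancel₀ _ h.ne']

/-- The change of measure behind importance sampling. -/
theorem lintegral_importance {μ : Measure Z} {p r : Z → ℝ} (hp : IsDensity μ p)
    (hr : IsDensity μ r) {G : Z → ℝ≥0∞} (hG : Measurable G)
    (hpos : ∀ᵐ z ∂(law μ p), G z ≠ 0 → 0 < r z) :
    ∫⁻ z, G z * ENNReal.ofReal (p z / r z) ∂(law μ r) = ∫⁻ z, G z ∂(law μ p) := by
  have hpm := hp.measurable
  have hrm := hr.measurable
  rw [lintegral_law hrm (by fun_prop), lintegral_law hpm hG]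
  rw [law, ae_withDensity_iff hpm.ennreal_ofReal] at hpos
  refine lintegral_congr_ae ?_
  filter_upwards [hpos] with z hz
  by_cases hp0 : p z = 0
  · simp [hp0]
  by_cases hG0 : G z = 0
  · simp [hG0]
  have hp' : 0 < p z := lt_of_le_of_ne (hp.nonneg z) (Ne.symm hp0)
  have hr' := hz (by simpa using hp') hG0
  rw [mul_left_comm, ← ENNReal.ofReal_mul hr'.le, mul_div_cancel₀ _ hr'.ne', mul_comm]

theorem lintegral_jointLaw_average (ν : Measure X) [IsProbabilityMeasure ν] (μ : Measure Z)
    [SigmaFinite μ] {N M : ℕ} (hM : 1 ≤ M) {pr : (Fin N → X) → Z → ℝ}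
    (hm : Measurable (Function.uncurry pr)) (hd : ∀ x, IsDensity μ (pr x))
    {k : (Fin N → X) → Z → ℝ≥0∞} (hk : Measurable (Function.uncurry k)) :
    ∫⁻ w, ENNReal.ofReal (1 / (M : ℝ)) * ∑ m, k w.1 (w.2 m) ∂(jointLaw ν μ pr M)
      = ∫⁻ x, ∫⁻ z, k x z ∂(law μ (pr x)) ∂(sampleLaw ν N) := by
  have hkm : ∀ m : Fin M, Measurable fun w : (Fin N → X) × (Fin M → Z) => k w.1 (w.2 m) := fun m =>
    hk.comp (f := fun w : (Fin N → X) × (Fin M → Z) => (w.1, w.2 m)) (by fun_prop)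
  rw [lintegral_jointLaw ν μ hm hd (by fun_prop)]
  refine lintegral_congr fun x => ?_
  have := (hd x).isProbabilityMeasure_law
  have hkx : Measurable (k x) := hk.comp measurable_prodMk_left
  rw [lintegral_const_mul _ (by fun_prop), lintegral_finsetSum _ (fun i _ => by fun_prop)]
  have h : ∀ m : Fin M, ∫⁻ z : Fin M → Z, k x (z m) ∂(Measure.pi fun _ : Fin M => law μ (pr x))
      = ∫⁻ z, k x z ∂(law μ (pr x)) := fun m =>
    (measurePreserving_eval (fun _ : Fin M => law μ (pr x)) m).lintegral_comp hkx
  simp only [h, Finset.sum_const, Finset.card_univ, Fintype.card_fin, nsmul_eq_mul]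
  have hM0 : (0 : ℝ) < M := by exact_mod_cast hM
  rw [← mul_assoc, ← ENNReal.ofReal_natCast, ← ENNReal.ofReal_mul (by positivity),
    one_div_mul_cancel hM0.ne', ENNReal.ofReal_one, one_mul]

/-- The importance-sampled estimator is unbiased for the random mixture estimator. -/
theorem expect_ramMC_eq (ν : Measure X) [IsProbabilityMeasure ν] (μ : Measure Z) [SigmaFinite μ]
    {p : Z → ℝ} {q : X → Z → ℝ} (hp : IsDensity μ p) (hq : Measurable (Function.uncurry q))
    (hqd : ∀ x, IsDensity μ (q x)) {f : ℝ → ℝ} (hf : ConvexOn ℝ (Ioi 0) f) (h1 : f 1 = 0)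
    {N M : ℕ} (hN : 1 ≤ N) (hM : 1 ≤ M) {pr : (Fin N → X) → Z → ℝ}
    (hpr : IsProposal f ν μ p q pr) :
    negPart (jointLaw ν μ pr M) (ramMC f p q pr) ≠ ⊤ ∧
      negPart (sampleLaw ν N) (ram f μ p q) ≠ ⊤ ∧
      expect (jointLaw ν μ pr M) (ramMC f p q pr) = expect (sampleLaw ν N) (ram f μ p q) := by
  obtain ⟨a, ha⟩ := exists_supporting_line hf h1
  have hpm := hp.measurable
  have hprm := hpr.measurable
  have hPprob := hp.isProbabilityMeasure_law
  set g : (Fin N → X) → Z → EReal := fun x z => extendZero f (mixture q x z / p z)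
  have hmix := measurable_mixture hq N
  have hratio : Measurable fun w : (Fin N → X) × Z => mixture q w.1 w.2 / p w.2 :=
    Measurable.div hmix (by fun_prop)
  have hg : Measurable (Function.uncurry g) :=
    (measurable_extendZero (hf.continuousOn isOpen_Ioi)).comp hratio
  have hgp : Measurable (Function.uncurry fun x z => (g x z).toENNReal) := hg.ereal_toENNReal
  have hgn : Measurable (Function.uncurry fun x z => (-g x z).toENNReal) :=
    hg.neg.ereal_toENNReal
  have hgpx : ∀ x, Measurable fun z => (g x z).toENNReal := fun x => hgp.of_uncurry_left
  have hgnx : ∀ x, Measurable fun z => (-g x z).toENNReal := fun x => hgn.of_uncurry_left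
  have hprior : ∀ x, ∀ z, 0 ≤ mixture q x z / p z := fun x z =>
    div_nonneg ((isDensity_mixture hqd hN x).nonneg z) (hp.nonneg z)
  set A : (Fin N → X) → ℝ≥0∞ := fun x => ∫⁻ z, (g x z).toENNReal ∂(law μ p)
  set B : (Fin N → X) → ℝ≥0∞ := fun x => ∫⁻ z, (-g x z).toENNReal ∂(law μ p)
  have hA : Measurable A := hgp.lintegral_prod_right'
  have hB : Measurable B := hgn.lintegral_prod_right'
  -- The bound does not depend on the sample, so the negative part of the RAM estimator is
  -- integrable even when its positive part is not.
  have hBle : ∀ x, B x ≤ ENNReal.ofReal |a| * 2 := by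
    intro x
    calc B x ≤ ∫⁻ z, ENNReal.ofReal |a| * (1 + ENNReal.ofReal (mixture q x z / p z)) ∂(law μ p) := by
          refine lintegral_mono fun z => (toENNReal_neg_extendZero_le ha (hprior x z)).trans ?_
          rw [ENNReal.ofReal_mul (abs_nonneg a), ENNReal.ofReal_add zero_le_one (hprior x z),
            ENNReal.ofReal_one]
      _ ≤ ENNReal.ofReal |a| * 2 := by
          have hx := (isDensity_mixture hqd hN x).measurable
          rw [lintegral_const_mul _ (by fun_prop), lintegral_add_left measurable_const,
            lintegral_one, measure_univ, ← one_add_one_eq_two]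
          gcongr
          exact lintegral_ratio_le hp (isDensity_mixture hqd hN x)
  have hBf : ∫⁻ x, B x ∂(sampleLaw ν N) ≠ ⊤ := by
    refine ne_top_of_le_ne_top ?_ (lintegral_mono hBle)
    simp [ENNReal.mul_eq_top]
  obtain ⟨hram, hramE⟩ := expect_eq_of_eq_sub (sampleLaw ν N) (g := ram f μ p q) hA hB hBf
    fun x => rfl
  set wt : (Fin N → X) → Z → ℝ := fun x z => p z / pr x z
  have hwt : Measurable (Function.uncurry wt) := by
    refine Measurable.div (f := fun w : (Fin N → X) × Z => p w.2) (by fun_prop) hprm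
  have hwt0 : ∀ x z, 0 ≤ wt x z := fun x z => div_nonneg (hp.nonneg z) ((hpr.isDensity x).nonneg z)
  set kp : (Fin N → X) → Z → ℝ≥0∞ := fun x z => (g x z).toENNReal * ENNReal.ofReal (wt x z)
  set kn : (Fin N → X) → Z → ℝ≥0∞ := fun x z => (-g x z).toENNReal * ENNReal.ofReal (wt x z)
  have hkp : Measurable (Function.uncurry kp) := Measurable.mul hgp hwt.ennreal_ofReal
  have hkn : Measurable (Function.uncurry kn) := Measurable.mul hgn hwt.ennreal_ofReal
  have hkpm : ∀ m : Fin M, Measurable fun w : (Fin N → X) × (Fin M → Z) => kp w.1 (w.2 m) :=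
    fun m => hkp.comp (f := fun w : (Fin N → X) × (Fin M → Z) => (w.1, w.2 m)) (by fun_prop)
  have hknm : ∀ m : Fin M, Measurable fun w : (Fin N → X) × (Fin M → Z) => kn w.1 (w.2 m) :=
    fun m => hkn.comp (f := fun w : (Fin N → X) × (Fin M → Z) => (w.1, w.2 m)) (by fun_prop)
  have hkn_top : ∀ x z, kn x z ≠ ⊤ := fun x z =>
    ENNReal.mul_ne_top (ne_top_of_le_ne_top ENNReal.ofReal_ne_top
      (toENNReal_neg_extendZero_le ha (hprior x z))) ENNReal.ofReal_ne_top
  -- A nonnegative weight passes through positive and negative parts, so the estimator is an average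
  -- of differences with finite subtrahend.
  have hterm : ∀ x z, g x z * ((wt x z : ℝ) : EReal) = (kp x z : EReal) - (kn x z : EReal) := by
    intro x z
    have h0 : (0 : EReal) ≤ ((wt x z : ℝ) : EReal) := EReal.coe_nonneg.2 (hwt0 x z)
    rw [← coe_toENNReal_sub_coe_toENNReal_neg (g x z * ((wt x z : ℝ) : EReal)), ← EReal.neg_mul,
      EReal.toENNReal_mul' h0, EReal.toENNReal_mul' h0, EReal.real_coe_toENNReal]
  have hIp : ∫⁻ x, ∫⁻ z, kp x z ∂(law μ (pr x)) ∂(sampleLaw ν N) = ∫⁻ x, A x ∂(sampleLaw ν N) := by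
    refine lintegral_congr_ae ?_
    filter_upwards [hpr.pos] with x hx
    refine lintegral_importance hp (hpr.isDensity x) (G := fun z => (g x z).toENNReal)
      (hgpx x) ?_
    filter_upwards [hx] with z hz h
    refine hz fun h0 => h ?_
    simp [g, h0]
  have hIn : ∫⁻ x, ∫⁻ z, kn x z ∂(law μ (pr x)) ∂(sampleLaw ν N) = ∫⁻ x, B x ∂(sampleLaw ν N) := by
    refine lintegral_congr_ae ?_
    filter_upwards [hpr.pos] with x hx
    refine lintegral_importance hp (hpr.isDensity x) (G := fun z => (-g x z).toENNReal)
      (hgnx x) ?_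
    filter_upwards [hx] with z hz h
    refine hz fun h0 => h ?_
    simp [g, h0]
  have hEp := lintegral_jointLaw_average ν μ hM hprm hpr.isDensity hkp
  have hEn := lintegral_jointLaw_average ν μ hM hprm hpr.isDensity hkn
  rw [hIp] at hEp
  rw [hIn] at hEn
  obtain ⟨hmc, hmcE⟩ := expect_eq_of_eq_sub (jointLaw ν μ pr M) (g := ramMC f p q pr)
    (A := fun w => ENNReal.ofReal (1 / (M : ℝ)) * ∑ m, kp w.1 (w.2 m))
    (B := fun w => ENNReal.ofReal (1 / (M : ℝ)) * ∑ m, kn w.1 (w.2 m))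
    (by fun_prop) (by fun_prop) (by rw [hEn]; exact hBf) (fun w => by
      have hc : ((ENNReal.ofReal (1 / (M : ℝ)) : ℝ≥0∞) : EReal) = ((1 / (M : ℝ) : ℝ) : EReal) := by
        rw [EReal.coe_ennreal_ofReal, max_eq_left (by positivity)]
      rw [EReal.coe_ennreal_mul, EReal.coe_ennreal_mul, hc,
        ← EReal.mul_sub_of_nonneg_of_ne_top (EReal.coe_nonneg.2 (by positivity))
          (EReal.coe_ne_top _), ← sum_coe_sub_coe _ _ _ fun m _ => hkn_top _ _]
      simp only [← hterm]
      rfl)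
  refine ⟨hmc, hram, ?_⟩
  rw [hmcE, hramE, hEp, hEn]

end Unbiased

/-! ### Increment bounds: general criteria and elementary generators. -/

/-- A quantitative bound on the increments of `f`, relative to `1 + t ^ 2 + f t ^ 2`. -/
def IncrementBound (f : ℝ → ℝ) : Prop :=
  ∃ C, 0 ≤ C ∧ ∀ t h, 0 ≤ h → h ≤ t →
    (t + t ^ 2) * (f t - f (t - h)) ^ 2 ≤ C * h ^ 2 * (1 + t ^ 2 + f t ^ 2)

/-- Convex generators, continuous at zero, with controlled increments. -/
structure RegularGenerator (f : ℝ → ℝ) : Prop where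
  convexOn : ConvexOn ℝ (Ici 0) f
  continuousOn : ContinuousOn f (Ici 0)
  map_one : f 1 = 0
  increment : IncrementBound f

theorem IncrementBound.of_weight {f : ℝ → ℝ} {C : ℝ} (hC : 0 ≤ C)
    (H : ∀ t, 0 < t → ∃ w, (∀ h, 0 ≤ h → h ≤ t → |f t - f (t - h)| ≤ h * w) ∧
      (t + t ^ 2) * w ^ 2 ≤ C * (1 + t ^ 2 + f t ^ 2)) : IncrementBound f := by
  refine ⟨C, hC, fun t h h0 hht => ?_⟩
  rcases (h0.trans hht).eq_or_lt' with rfl | ht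
  · obtain rfl : h = 0 := le_antisymm hht h0
    simp
  obtain ⟨w, hw, hb⟩ := H t ht
  have h1 : (f t - f (t - h)) ^ 2 ≤ (h * w) ^ 2 := sq_le_sq' (by
    have := neg_le_of_abs_le (hw h h0 hht); linarith) (le_of_abs_le (hw h h0 hht))
  calc (t + t ^ 2) * (f t - f (t - h)) ^ 2 ≤ (t + t ^ 2) * (h * w) ^ 2 := by gcongr
    _ = h ^ 2 * ((t + t ^ 2) * w ^ 2) := by ring
    _ ≤ h ^ 2 * (C * (1 + t ^ 2 + f t ^ 2)) := by gcongr
    _ = C * h ^ 2 * (1 + t ^ 2 + f t ^ 2) := by ring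

/-- Since `k ≠ 0`, the relation can be inverted, so the growths of `f` and `g` are comparable; the
linear term adds `b * h` to the increment, and `t + t ^ 2` is itself dominated by the growth. -/
theorem IncrementBound.affine {f g : ℝ → ℝ} (hf : IncrementBound f) {k b d : ℝ} (hk : k ≠ 0)
    (hg : ∀ t, g t = k * f t + (b * t + d)) : IncrementBound g := by
  obtain ⟨C, hC, H⟩ := hf
  have hk2 : 0 < k ^ 2 := by positivity
  set L : ℝ := 1 + 3 * (1 + b ^ 2 + d ^ 2) / k ^ 2
  have hL : 0 ≤ L := by positivity
  refine ⟨2 * k ^ 2 * C * L + 4 * b ^ 2, by positivity, fun t h h0 hht => ?_⟩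
  have ht : 0 ≤ t := h0.trans hht
  have hf2 : f t ^ 2 ≤ 3 * (1 + b ^ 2 + d ^ 2) / k ^ 2 * (1 + t ^ 2 + g t ^ 2) := by
    rw [div_mul_eq_mul_div, le_div_iff₀ hk2]
    have e : f t ^ 2 * k ^ 2 = (g t - b * t - d) ^ 2 := by rw [hg]; ring
    rw [e]
    nlinarith [sq_nonneg (g t + b * t), sq_nonneg (g t + d), sq_nonneg (b * t - d),
      sq_nonneg (b * g t), sq_nonneg (d * t), sq_nonneg (d * g t), sq_nonneg (b * t),
      sq_nonneg (g t), sq_nonneg t, sq_nonneg b, sq_nonneg d]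
  have hV : 1 + t ^ 2 + f t ^ 2 ≤ L * (1 + t ^ 2 + g t ^ 2) := by
    have : L * (1 + t ^ 2 + g t ^ 2) = (1 + t ^ 2 + g t ^ 2)
        + 3 * (1 + b ^ 2 + d ^ 2) / k ^ 2 * (1 + t ^ 2 + g t ^ 2) := by simp only [L]; ring
    rw [this]
    nlinarith [sq_nonneg (g t)]
  have hd : (g t - g (t - h)) ^ 2 ≤ 2 * k ^ 2 * (f t - f (t - h)) ^ 2 + 2 * b ^ 2 * h ^ 2 := by
    rw [hg, hg]
    nlinarith [sq_nonneg (k * (f t - f (t - h)) - b * h)]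
  have ht2 : t + t ^ 2 ≤ 2 * (1 + t ^ 2 + g t ^ 2) := by
    nlinarith [sq_nonneg (t - 1), sq_nonneg (g t), sq_nonneg t]
  calc (t + t ^ 2) * (g t - g (t - h)) ^ 2
      ≤ (t + t ^ 2) * (2 * k ^ 2 * (f t - f (t - h)) ^ 2 + 2 * b ^ 2 * h ^ 2) := by gcongr
    _ = 2 * k ^ 2 * ((t + t ^ 2) * (f t - f (t - h)) ^ 2) + 2 * b ^ 2 * h ^ 2 * (t + t ^ 2) := by
        ring
    _ ≤ 2 * k ^ 2 * (C * h ^ 2 * (L * (1 + t ^ 2 + g t ^ 2)))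
        + 2 * b ^ 2 * h ^ 2 * (2 * (1 + t ^ 2 + g t ^ 2)) := by
        have := (H t h h0 hht).trans (mul_le_mul_of_nonneg_left hV (by positivity))
        gcongr
    _ = (2 * k ^ 2 * C * L + 4 * b ^ 2) * h ^ 2 * (1 + t ^ 2 + g t ^ 2) := by ring

/-- The tangent at `t` bounds the increment from above, and the chord from `0` to `t` bounds it from
below; hence the two conditions on `w`. -/
theorem _root_.ConvexOn.abs_sub_le_mul {f : ℝ → ℝ} (hf : ConvexOn ℝ (Ici 0) f) {t d w h : ℝ}
    (ht : 0 < t) (hd : HasDerivAt f d t) (hdw : d ≤ w) (h0w : |f t - f 0| ≤ t * w)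
    (h0 : 0 ≤ h) (hht : h ≤ t) : |f t - f (t - h)| ≤ h * w := by
  rcases h0.eq_or_lt' with rfl | hpos
  · simp
  rw [abs_le]
  constructor
  · have hc := hf.2 (mem_Ici.2 ht.le) (mem_Ici.2 le_rfl)
      (show 0 ≤ 1 - h / t by rw [sub_nonneg, div_le_one ht]; exact hht)
      (show 0 ≤ h / t by positivity) (by ring)
    have e : (1 - h / t) • t + (h / t) • (0 : ℝ) = t - h := by
      simp only [smul_eq_mul]; field_simp; ring
    rw [e] at hc
    simp only [smul_eq_mul] at hc
    have h2 : h / t * (f t - f 0) ≥ h / t * (-(t * w)) := by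
      gcongr
      exact neg_le_of_abs_le h0w
    have h3 : h / t * (-(t * w)) = -(h * w) := by field_simp
    linarith
  · have hs := hf.slope_le_of_hasDerivAt (mem_Ici.2 (sub_nonneg.2 hht)) (mem_Ici.2 ht.le)
      (by linarith) hd
    rw [slope_def_field, div_le_iff₀ (by linarith)] at hs
    have : d * (t - (t - h)) ≤ h * w := by
      rw [sub_sub_cancel, mul_comm]; gcongr
    linarith

theorem _root_.ConcaveOn.abs_sub_le_mul {f : ℝ → ℝ} (hf : ConcaveOn ℝ (Ici 0) f)
    (hm : MonotoneOn f (Ici 0)) {t h : ℝ} (ht : 0 < t) (h0 : 0 ≤ h) (hht : h ≤ t) :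
    |f t - f (t - h)| ≤ h * ((f t - f 0) / t) := by
  rw [abs_of_nonneg (sub_nonneg.2 (hm (mem_Ici.2 (sub_nonneg.2 hht)) (mem_Ici.2 ht.le)
    (by linarith)))]
  have hc := hf.2 (mem_Ici.2 ht.le) (mem_Ici.2 le_rfl)
    (show 0 ≤ 1 - h / t by rw [sub_nonneg, div_le_one ht]; exact hht)
    (show 0 ≤ h / t by positivity) (by ring)
  have e : (1 - h / t) • t + (h / t) • (0 : ℝ) = t - h := by
    simp only [smul_eq_mul]; field_simp; ring
  rw [e] at hc
  simp only [smul_eq_mul] at hc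
  have : h * ((f t - f 0) / t) = h / t * (f t - f 0) := by ring
  rw [this]
  linarith

/-- With `u = √t`, the bounds `1 - u⁻¹ ≤ log u ≤ u - 1` control `u * log u`, whose square is a
quarter of the left side. -/
theorem mul_log_sq_le {t : ℝ} (ht : 0 < t) : t * Real.log t ^ 2 ≤ 8 * (1 + t ^ 2) := by
  set u := √t
  have hu : 0 < u := Real.sqrt_pos.2 ht
  have hut : u ^ 2 = t := Real.sq_sqrt ht.le
  have hl : Real.log t = 2 * Real.log u := by rw [← hut, Real.log_pow]; norm_num
  have h1 : Real.log u ≤ u - 1 := Real.log_le_sub_one_of_pos hu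
  have h2 : 1 - u⁻¹ ≤ Real.log u := Real.one_sub_inv_le_log_of_pos hu
  have h3 : |u * Real.log u| ≤ u ^ 2 + 1 := by
    rw [abs_le]
    constructor
    · have : u * (1 - u⁻¹) ≤ u * Real.log u := by gcongr
      have e : u * (1 - u⁻¹) = u - 1 := by field_simp
      nlinarith [sq_nonneg u]
    · have : u * Real.log u ≤ u * (u - 1) := by gcongr
      nlinarith
  have h4 : (u * Real.log u) ^ 2 ≤ (u ^ 2 + 1) ^ 2 := by
    rw [← sq_abs]; gcongr
  rw [hl]
  have : t * (2 * Real.log u) ^ 2 = 4 * (u * Real.log u) ^ 2 := by rw [← hut]; ring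
  rw [this, ← hut]
  nlinarith [sq_nonneg (u ^ 2 - 1)]

theorem incrementBound_mul_log : IncrementBound fun t => t * Real.log t := by
  refine IncrementBound.of_weight (C := 22) (by norm_num) fun t ht =>
    ⟨|Real.log t| + 1, fun h h0 hht => ?_, ?_⟩
  · refine Real.convexOn_mul_log.abs_sub_le_mul ht (Real.hasDerivAt_mul_log ht.ne') ?_ ?_ h0 hht
    · gcongr
      exact le_abs_self _
    · simp only [zero_mul, sub_zero, abs_mul, abs_of_pos ht]
      gcongr
      linarith
  · have h1 := mul_log_sq_le ht
    have h2 : (|Real.log t| + 1) ^ 2 ≤ 2 * Real.log t ^ 2 + 2 := by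
      rw [← sq_abs (Real.log t)]
      nlinarith [sq_nonneg (|Real.log t| - 1)]
    -- The `t * log² t` term is handled by `mul_log_sq_le`; the `t ^ 2 * log² t` term is the square
    -- of the function itself and is absorbed by the growth.
    calc (t + t ^ 2) * (|Real.log t| + 1) ^ 2 ≤ (t + t ^ 2) * (2 * Real.log t ^ 2 + 2) := by gcongr
      _ ≤ 22 * (1 + t ^ 2 + (t * Real.log t) ^ 2) := by
        nlinarith [sq_nonneg (t * Real.log t), sq_nonneg (t - 1)]

theorem incrementBound_of_lipschitz {f : ℝ → ℝ}
    (H : ∀ t h, 0 ≤ h → h ≤ t → |f t - f (t - h)| ≤ h) : IncrementBound f := by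
  refine IncrementBound.of_weight (C := 2) (by norm_num) fun t ht =>
    ⟨1, fun h h0 hht => by simpa using H t h h0 hht, ?_⟩
  nlinarith [sq_nonneg (t - 1), sq_nonneg (f t)]

theorem incrementBound_sq : IncrementBound fun t => t ^ 2 := by
  refine IncrementBound.of_weight (C := 8) (by norm_num) fun t ht =>
    ⟨2 * t, fun h h0 hht => ?_, ?_⟩
  · have e : t ^ 2 - (t - h) ^ 2 = h * (2 * t - h) := by ring
    rw [e, abs_of_nonneg (mul_nonneg h0 (by linarith))]
    gcongr
    linarith
  · nlinarith [sq_nonneg (t * (t - 1)), sq_nonneg t, sq_nonneg (t ^ 2)]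

/-- The chord slope `(f t - f 0) / t` is the weight. Near zero, the weighted square is of order `t ^
(2 * γ - 1)`, bounded exactly because `γ ≥ 1/2`; for large `t` the growth is linear. This is where
the parameter ranges of the power-type generators enter. -/
theorem incrementBound_of_concave {f : ℝ → ℝ} (hf : ConcaveOn ℝ (Ici 0) f)
    (hm : MonotoneOn f (Ici 0)) {γ : ℝ} (hγ : 1 / 2 ≤ γ) {K : ℝ}
    (h_le_one : ∀ t, 0 < t → t ≤ 1 → f t - f 0 ≤ K * t ^ γ)
    (h_one_le : ∀ t, 1 ≤ t → f t - f 0 ≤ K * t) : IncrementBound f := by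
  refine IncrementBound.of_weight (C := 2 * K ^ 2) (by positivity) fun t ht =>
    ⟨(f t - f 0) / t, fun h h0 hht => hf.abs_sub_le_mul hm ht h0 hht, ?_⟩
  have h0 : 0 ≤ f t - f 0 := sub_nonneg.2 (hm (mem_Ici.2 le_rfl) (mem_Ici.2 ht.le) ht.le)
  have key : (f t - f 0) ^ 2 ≤ K ^ 2 * (t + t ^ 2) ∧ (t + 1) * (f t - f 0) ^ 2 ≤
      2 * K ^ 2 * t * (1 + t ^ 2) := by
    rcases le_total t 1 with h1 | h1
    · have h2 : (f t - f 0) ^ 2 ≤ K ^ 2 * t := by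
        calc (f t - f 0) ^ 2 ≤ (K * t ^ γ) ^ 2 := by gcongr; exact h_le_one t ht h1
          _ = K ^ 2 * t ^ (γ * 2) := by rw [mul_pow, Real.rpow_mul ht.le]; norm_num
          _ ≤ K ^ 2 * t := by
            gcongr
            calc t ^ (γ * 2) ≤ t ^ (1 : ℝ) := Real.rpow_le_rpow_of_exponent_ge ht h1 (by linarith)
              _ = t := Real.rpow_one t
      refine ⟨h2.trans (by gcongr; nlinarith), ?_⟩
      calc (t + 1) * (f t - f 0) ^ 2 ≤ 2 * (K ^ 2 * t) := by gcongr; linarith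
        _ = 2 * K ^ 2 * t * 1 := by ring
        _ ≤ 2 * K ^ 2 * t * (1 + t ^ 2) := by gcongr; nlinarith
    · have h2 : (f t - f 0) ^ 2 ≤ K ^ 2 * t ^ 2 := by
        rw [← mul_pow]; gcongr; exact h_one_le t h1
      refine ⟨h2.trans (by gcongr; linarith), ?_⟩
      calc (t + 1) * (f t - f 0) ^ 2 ≤ (t + t) * (K ^ 2 * t ^ 2) := by gcongr
        _ = 2 * K ^ 2 * t * t ^ 2 := by ring
        _ ≤ 2 * K ^ 2 * t * (1 + t ^ 2) := by gcongr; linarith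
  have e : (t + t ^ 2) * ((f t - f 0) / t) ^ 2 = (t + 1) * (f t - f 0) ^ 2 / t := by
    field_simp
    ring
  rw [e, div_le_iff₀ ht]
  calc (t + 1) * (f t - f 0) ^ 2 ≤ 2 * K ^ 2 * t * (1 + t ^ 2) := key.2
    _ ≤ 2 * K ^ 2 * (1 + t ^ 2 + f t ^ 2) * t := by
      have : 2 * K ^ 2 * (1 + t ^ 2 + f t ^ 2) * t
          = 2 * K ^ 2 * t * (1 + t ^ 2) + 2 * K ^ 2 * t * f t ^ 2 := by ring
      rw [this]
      have : 0 ≤ 2 * K ^ 2 * t * f t ^ 2 := by positivity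
      linarith

theorem incrementBound_rpow {γ : ℝ} (h0 : 1 / 2 ≤ γ) (h1 : γ ≤ 1) :
    IncrementBound fun t => t ^ γ := by
  have hγ : 0 < γ := by linarith
  refine incrementBound_of_concave (Real.concaveOn_rpow hγ.le h1)
    (Real.monotoneOn_rpow_Ici_of_exponent_nonneg hγ.le) h0 (K := 1)
    (fun t _ _ => ?_) fun t ht => ?_
  · simp [Real.zero_rpow hγ.ne']
  · rw [Real.zero_rpow hγ.ne', sub_zero, one_mul]
    exact (Real.rpow_le_rpow_of_exponent_le ht h1).trans_eq (Real.rpow_one t)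

theorem hasDerivAt_mul_log_sub {t : ℝ} (ht : 0 < t) :
    HasDerivAt (fun t => t * Real.log t - (1 + t) * Real.log (1 + t))
      (Real.log t - Real.log (1 + t)) t := by
  have h1 := Real.hasDerivAt_mul_log ht.ne'
  have h2 : HasDerivAt (fun t => (1 + t) * Real.log (1 + t)) ((Real.log (1 + t) + 1) * 1) t :=
    (Real.hasDerivAt_mul_log (x := 1 + t) (by linarith)).comp t ((hasDerivAt_id t).const_add 1)
  exact (h1.sub h2).congr_deriv (by ring)

theorem continuous_mul_log_sub :
    Continuous fun t : ℝ => t * Real.log t - (1 + t) * Real.log (1 + t) :=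
  Real.continuous_mul_log.sub (Real.continuous_mul_log.comp (continuous_const.add continuous_id))

theorem convexOn_mul_log_sub :
    ConvexOn ℝ (Ici 0) fun t => t * Real.log t - (1 + t) * Real.log (1 + t) := by
  refine MonotoneOn.convexOn_of_deriv (convex_Ici 0) continuous_mul_log_sub.continuousOn ?_ ?_
  · rw [interior_Ici]
    exact fun t ht => (hasDerivAt_mul_log_sub ht).differentiableAt.differentiableWithinAt
  · rw [interior_Ici]
    intro s hs t ht hst
    rw [mem_Ioi] at hs ht
    rw [(hasDerivAt_mul_log_sub hs).deriv, (hasDerivAt_mul_log_sub ht).deriv,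
      ← Real.log_div hs.ne' (by linarith), ← Real.log_div ht.ne' (by linarith)]
    refine Real.log_le_log (by positivity) ?_
    rw [div_le_div_iff₀ (by linarith) (by linarith)]
    nlinarith

theorem incrementBound_mul_log_sub :
    IncrementBound fun t => t * Real.log t - (1 + t) * Real.log (1 + t) := by
  refine IncrementBound.of_weight (C := 24) (by norm_num) fun t ht =>
    ⟨Real.log (1 + t) - Real.log t + 1, fun h h0 hht => ?_, ?_⟩
  · have hle : Real.log t ≤ Real.log (1 + t) := Real.log_le_log ht (by linarith)
    refine convexOn_mul_log_sub.abs_sub_le_mul ht (hasDerivAt_mul_log_sub ht) (by linarith) ?_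
      h0 hht
    have h1 : Real.log (1 + t) ≤ t := by
      linarith [Real.log_le_sub_one_of_pos (x := 1 + t) (by linarith)]
    have h2 : 0 ≤ Real.log (1 + t) := Real.log_nonneg (by linarith)
    have h3 : t * Real.log t ≤ t * Real.log (1 + t) := by gcongr
    simp only [zero_mul, add_zero, Real.log_one, mul_zero, sub_zero]
    rw [abs_le]
    constructor <;> nlinarith
  -- The derivative has only a logarithmic singularity at zero: `log v ≤ 2 * √v` suffices, as `(t +
  -- t ^ 2) * v = (1 + t) ^ 2`.
  · set v := (1 + t) / t
    have hv : 0 < v := by positivity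
    have hl : Real.log (1 + t) - Real.log t = Real.log v :=
      (Real.log_div (by linarith) ht.ne').symm
    have hv1 : 1 ≤ v := by rw [le_div_iff₀ ht]; linarith
    have h0 : 0 ≤ Real.log v := Real.log_nonneg hv1
    have h1 : Real.log v ≤ 2 * √v := by
      have e : Real.log v = 2 * Real.log √v := by
        rw [Real.log_sqrt hv.le]; ring
      have := Real.log_le_sub_one_of_pos (Real.sqrt_pos.2 hv)
      linarith
    have h2 : Real.log v ^ 2 ≤ 4 * v := by
      calc Real.log v ^ 2 ≤ (2 * √v) ^ 2 := by gcongr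
        _ = 4 * v := by rw [mul_pow, Real.sq_sqrt hv.le]; norm_num
    rw [hl]
    have h3 : (Real.log v + 1) ^ 2 ≤ 2 * (4 * v) + 2 := by nlinarith [sq_nonneg (Real.log v - 1)]
    calc (t + t ^ 2) * (Real.log v + 1) ^ 2 ≤ (t + t ^ 2) * (2 * (4 * v) + 2) := by gcongr
      _ = 8 * (1 + t) ^ 2 + 2 * (t + t ^ 2) := by simp only [v]; field_simp; ring
      _ ≤ 24 * (1 + t ^ 2 + (t * Real.log t - (1 + t) * Real.log (1 + t)) ^ 2) := by
        nlinarith [sq_nonneg (t - 1), sq_nonneg (t * Real.log t - (1 + t) * Real.log (1 + t))]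

/-! ### The power-type function behind `fBeta`. -/

section PowerMean

variable {β : ℝ}

/-- In this form the derivative is a power of the decreasing function `t ^ (-β) + 1`, so the sign of
`1 / β - 1` decides between convexity and concavity. -/
theorem hasDerivAt_one_add_rpow_rpow (hβ : 0 < β) {t : ℝ} (ht : 0 < t) :
    HasDerivAt (fun t : ℝ => (1 + t ^ β) ^ (1 / β)) ((t ^ (-β) + 1) ^ (1 / β - 1)) t := by
  have hp : 0 < t ^ β := Real.rpow_pos_of_pos ht β
  have h1 : HasDerivAt (fun t : ℝ => 1 + t ^ β) (β * t ^ (β - 1)) t :=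
    (Real.hasDerivAt_rpow_const (Or.inl ht.ne')).const_add 1
  have h2 := h1.rpow_const (p := 1 / β) (Or.inl (by positivity : (1 : ℝ) + t ^ β ≠ 0))
  convert h2 using 1
  have e : t ^ (-β) + 1 = (1 + t ^ β) * t ^ (-β) := by
    rw [add_mul, ← Real.rpow_add ht]; simp
  rw [e, Real.mul_rpow (by positivity) (by positivity), ← Real.rpow_mul ht.le]
  have e2 : -β * (1 / β - 1) = β - 1 := by field_simp; ring
  rw [e2]
  field_simp

theorem continuous_one_add_rpow_rpow (hβ : 0 < β) :
    Continuous fun t : ℝ => (1 + t ^ β) ^ (1 / β) :=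
  (continuous_const.add (Real.continuous_rpow_const hβ.le)).rpow_const
    fun _ => Or.inr (by positivity)

theorem rpow_neg_add_one_le (hβ : 0 < β) {s t : ℝ} (hs : 0 < s) (hst : s ≤ t) :
    t ^ (-β) + 1 ≤ s ^ (-β) + 1 := by
  gcongr 1
  exact Real.rpow_le_rpow_of_nonpos hs hst (by linarith)

theorem convexOn_one_add_rpow_rpow (hβ : 1 < β) :
    ConvexOn ℝ (Ici 0) fun t : ℝ => (1 + t ^ β) ^ (1 / β) := by
  have h0 : 0 < β := by linarith
  refine MonotoneOn.convexOn_of_deriv (convex_Ici 0)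
    (continuous_one_add_rpow_rpow h0).continuousOn ?_ ?_
  · rw [interior_Ici]
    exact fun t ht => (hasDerivAt_one_add_rpow_rpow h0 ht).differentiableAt.differentiableWithinAt
  · rw [interior_Ici]
    intro s hs t ht hst
    rw [mem_Ioi] at hs ht
    rw [(hasDerivAt_one_add_rpow_rpow h0 hs).deriv, (hasDerivAt_one_add_rpow_rpow h0 ht).deriv]
    refine Real.rpow_le_rpow_of_nonpos (by positivity) (rpow_neg_add_one_le h0 hs hst) ?_
    rw [sub_nonpos, div_le_one h0]
    exact hβ.le

theorem concaveOn_one_add_rpow_rpow (h0 : 0 < β) (hβ : β < 1) :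
    ConcaveOn ℝ (Ici 0) fun t : ℝ => (1 + t ^ β) ^ (1 / β) := by
  refine AntitoneOn.concaveOn_of_deriv (convex_Ici 0)
    (continuous_one_add_rpow_rpow h0).continuousOn ?_ ?_
  · rw [interior_Ici]
    exact fun t ht => (hasDerivAt_one_add_rpow_rpow h0 ht).differentiableAt.differentiableWithinAt
  · rw [interior_Ici]
    intro s hs t ht hst
    rw [mem_Ioi] at hs ht
    rw [(hasDerivAt_one_add_rpow_rpow h0 hs).deriv, (hasDerivAt_one_add_rpow_rpow h0 ht).deriv]
    refine Real.rpow_le_rpow (by positivity) (rpow_neg_add_one_le h0 hs hst) ?_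
    rw [sub_nonneg, one_le_div h0]
    exact hβ.le

theorem monotoneOn_one_add_rpow_rpow (h0 : 0 < β) :
    MonotoneOn (fun t : ℝ => (1 + t ^ β) ^ (1 / β)) (Ici 0) := by
  intro s hs t _ hst
  rw [mem_Ici] at hs
  have : 0 ≤ s ^ β := Real.rpow_nonneg hs β
  dsimp only
  gcongr

/-- The function is 1-Lipschitz: its derivative is at most one, and its chord from zero has slope at
most one by superadditivity of `t ↦ t ^ β`. -/
theorem incrementBound_one_add_rpow_rpow_of_one_lt (hβ : 1 < β) :
    IncrementBound fun t : ℝ => (1 + t ^ β) ^ (1 / β) := by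
  have h0 : 0 < β := by linarith
  refine incrementBound_of_lipschitz fun t h hh hht => ?_
  rcases (hh.trans hht).eq_or_lt' with rfl | ht
  · obtain rfl : h = 0 := le_antisymm hht hh
    simp
  have key := (convexOn_one_add_rpow_rpow hβ).abs_sub_le_mul (w := 1) ht
    (hasDerivAt_one_add_rpow_rpow h0 ht) ?_ ?_ hh hht
  · simpa using key
  · refine Real.rpow_le_one_of_one_le_of_nonpos (by
      have := Real.rpow_nonneg ht.le (-β); linarith) ?_
    rw [sub_nonpos, div_le_one h0]
    exact hβ.le
  · rw [abs_of_nonneg (sub_nonneg.2 (monotoneOn_one_add_rpow_rpow h0 (mem_Ici.2 le_rfl)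
      (mem_Ici.2 ht.le) ht.le))]
    have h1 : (1 : ℝ) + t ^ β ≤ (1 + t) ^ β := by
      simpa using Real.add_rpow_le_rpow_add zero_le_one ht.le hβ.le
    have h2 : (1 + t ^ β) ^ (1 / β) ≤ 1 + t := by
      calc (1 + t ^ β) ^ (1 / β) ≤ ((1 + t) ^ β) ^ (1 / β) := by
            have := Real.rpow_nonneg ht.le β
            gcongr
        _ = 1 + t := by
          rw [← Real.rpow_mul (by linarith), mul_one_div_cancel h0.ne', Real.rpow_one]
    simp only [Real.zero_rpow h0.ne', add_zero, Real.one_rpow]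
    linarith

theorem incrementBound_one_add_rpow_rpow_of_lt_one (h12 : 1 / 2 < β) (hβ : β < 1) :
    IncrementBound fun t : ℝ => (1 + t ^ β) ^ (1 / β) := by
  have h0 : 0 < β := by linarith
  have hb2 : 1 / β ≤ 2 := by rw [div_le_iff₀ h0]; linarith
  -- Because `1 / β ≤ 2`, the increment from zero is at most `(1 + t ^ β) ^ 2 - 1 ≤ 3 * t ^ β` on
  -- `(0, 1]`, and the function is at most `2 ^ (1 / β) * t ≤ 4 * t` beyond; `K = 4` covers both.
  refine incrementBound_of_concave (concaveOn_one_add_rpow_rpow h0 hβ)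
    (monotoneOn_one_add_rpow_rpow h0) h12.le (K := 4)
    (fun t ht ht1 => ?_) fun t ht => ?_
  · simp only [Real.zero_rpow h0.ne', add_zero, Real.one_rpow]
    have hu : 0 ≤ t ^ β := Real.rpow_nonneg ht.le β
    have hu1 : t ^ β ≤ 1 := Real.rpow_le_one ht.le ht1 h0.le
    have h1 : (1 + t ^ β) ^ (1 / β) ≤ (1 + t ^ β) ^ (2 : ℝ) :=
      Real.rpow_le_rpow_of_exponent_le (by linarith) hb2
    rw [Real.rpow_two] at h1
    nlinarith
  · simp only [Real.zero_rpow h0.ne', add_zero, Real.one_rpow]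
    have ht0 : 0 ≤ t := by linarith
    have hu1 : 1 ≤ t ^ β := Real.one_le_rpow ht h0.le
    have h1 : (1 + t ^ β) ^ (1 / β) ≤ (2 * t ^ β) ^ (1 / β) := by
      gcongr
      linarith
    rw [Real.mul_rpow (by norm_num) (by linarith), ← Real.rpow_mul ht0,
      mul_one_div_cancel h0.ne', Real.rpow_one] at h1
    have h2 : (2 : ℝ) ^ (1 / β) ≤ 2 ^ (2 : ℝ) :=
      Real.rpow_le_rpow_of_exponent_le (by norm_num) hb2
    rw [Real.rpow_two] at h2
    nlinarith

end PowerMean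

/-! ### The generators of the table are regular, and their rates dominate `N ^ (-1/2)`. -/

theorem convexOn_affine (k d : ℝ) : ConvexOn ℝ (Ici (0 : ℝ)) fun t => k * t + d :=
  ⟨convex_Ici 0, fun x _ y _ a b _ _ hab => le_of_eq (by
    simp only [smul_eq_mul]
    linear_combination (-d) * hab)⟩

theorem RegularGenerator.of_affine {f g : ℝ → ℝ} {k b d : ℝ} (hk : k ≠ 0)
    (hg : ∀ t, 0 ≤ t → g t = k * f t + (b * t + d)) (hc : ConvexOn ℝ (Ici 0) fun t => k * f t)
    (hcont : ContinuousOn f (Ici 0)) (h1 : g 1 = 0) (hi : IncrementBound f) :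
    RegularGenerator g := by
  have hEq : EqOn (fun t => k * f t + (b * t + d)) g (Ici 0) := fun t ht => (hg t ht).symm
  refine ⟨(hc.add (convexOn_affine b d)).congr hEq, ?_, h1, ?_⟩
  · refine ContinuousOn.congr (f := fun t => k * f t + (b * t + d)) ?_ fun t ht => hg t ht
    fun_prop
  · obtain ⟨C, hC, H⟩ := hi.affine (g := fun t => k * f t + (b * t + d)) hk fun t => rfl
    refine ⟨C, hC, fun t h h0 hht => ?_⟩
    rw [hg t (h0.trans hht), hg _ (sub_nonneg.2 hht)]
    exact H t h h0 hht

namespace Divergence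

theorem regularGenerator_gen {D : Divergence} (hD : D.Admissible) (c : ℝ) :
    RegularGenerator (D.gen c) := by
  cases D with
  | kl =>
    refine RegularGenerator.of_affine (k := 1) (b := c - 1) (d := 1 - c) one_ne_zero
      (f := fun t => t * Real.log t) (fun t _ => ?_) ?_ Real.continuous_mul_log.continuousOn ?_
      incrementBound_mul_log
    · simp only [gen, f₀]; ring
    · simpa using Real.convexOn_mul_log
    · simp [gen, f₀]
  | tv =>
    refine RegularGenerator.of_affine (k := 1 / 2) (b := c) (d := -c) (by norm_num)
      (f := fun t => |1 - t|) (fun t _ => ?_) ?_ (by fun_prop) ?_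
      (incrementBound_of_lipschitz fun t h h0 _ => ?_)
    · simp only [gen, f₀]; ring
    · have h : ConvexOn ℝ (Ici 0) fun t : ℝ => |1 - t| := by
        refine ⟨convex_Ici 0, fun x _ y _ a b ha hb hab => ?_⟩
        simp only [smul_eq_mul]
        have e : 1 - (a * x + b * y) = a * (1 - x) + b * (1 - y) := by linear_combination -hab
        rw [e]
        refine (abs_add_le _ _).trans_eq ?_
        rw [abs_mul, abs_mul, abs_of_nonneg ha, abs_of_nonneg hb]
      exact h.smul (c := 1 / 2) (by norm_num)
    · simp [gen, f₀]
    · refine (abs_abs_sub_abs_le _ _).trans_eq ?_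
      rw [show 1 - t - (1 - (t - h)) = -h by ring, abs_neg, abs_of_nonneg h0]
  | chiSq =>
    refine RegularGenerator.of_affine (k := 1) (b := c - 2) (d := 1 - c) one_ne_zero
      (f := fun t => t ^ 2) (fun t _ => ?_) ?_ (by fun_prop) ?_ incrementBound_sq
    · simp only [gen, f₀]; ring
    · simpa using convexOn_pow 2
    · simp [gen, f₀]
  | js =>
    refine RegularGenerator.of_affine (k := 1) (b := Real.log 2 + c) (d := Real.log 2 - c)
      one_ne_zero (f := fun t => t * Real.log t - (1 + t) * Real.log (1 + t)) (fun t ht => ?_) ?_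
      continuous_mul_log_sub.continuousOn ?_ incrementBound_mul_log_sub
    · simp only [gen, f₀]
      rw [Real.log_div (by norm_num) (by linarith)]
      ring
    · simpa using convexOn_mul_log_sub
    · simp only [gen, f₀]; norm_num
  | fBeta β =>
    obtain ⟨h12, hne⟩ := hD
    have h0 : 0 < β := by linarith
    have hk : 1 - 1 / β ≠ 0 := by
      rw [sub_ne_zero, ne_comm, Ne, div_eq_one_iff_eq h0.ne']
      exact hne.symm
    have h1 : gen (fBeta β) c 1 = 0 := by
      have e : (2 : ℝ) ^ (1 / β - 1) * 2 = 2 ^ (1 / β) := by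
        rw [Real.rpow_sub_one (by norm_num)]; field_simp
      simp only [gen, f₀, Real.one_rpow, one_add_one_eq_two]
      rw [e]
      ring
    refine RegularGenerator.of_affine (k := 1 / (1 - 1 / β))
      (b := c - 1 / (1 - 1 / β) * (2 : ℝ) ^ (1 / β - 1))
      (d := -c - 1 / (1 - 1 / β) * (2 : ℝ) ^ (1 / β - 1)) (one_div_ne_zero hk)
      (f := fun t => (1 + t ^ β) ^ (1 / β)) (fun t _ => ?_) ?_
      (continuous_one_add_rpow_rpow h0).continuousOn h1 ?_
    · simp only [gen, f₀]; ring
    -- The prefactor changes sign at `β = 1` together with the switch from concave to convex, so the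
    -- generator is convex on both sides.
    · rcases lt_or_gt_of_ne hne with hlt | hgt
      · have hneg : 0 ≤ -(1 / (1 - 1 / β)) := by
          rw [neg_nonneg, one_div_nonpos, sub_nonpos, one_le_div h0]
          exact hlt.le
        refine ((concaveOn_one_add_rpow_rpow h0 hlt).neg.smul hneg).congr fun t _ => ?_
        simp
      · have hpos : 0 ≤ 1 / (1 - 1 / β) := by
          rw [one_div_nonneg, sub_nonneg, div_le_one h0]
          exact hgt.le
        exact (convexOn_one_add_rpow_rpow hgt).smul hpos
    · rcases lt_or_gt_of_ne hne with hlt | hgt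
      · exact incrementBound_one_add_rpow_rpow_of_lt_one h12 hlt
      · exact incrementBound_one_add_rpow_rpow_of_one_lt hgt
  | fAlpha α =>
    obtain ⟨h13, h1⟩ := hD
    have hk : 0 < 4 / (1 - α ^ 2) := div_pos (by norm_num) (by nlinarith)
    have hg0 : 0 ≤ (1 + α) / 2 := by linarith
    have hg1 : (1 + α) / 2 ≤ 1 := by linarith
    refine RegularGenerator.of_affine (k := -(4 / (1 - α ^ 2))) (b := c - 2 / (α - 1))
      (d := 4 / (1 - α ^ 2) + 2 / (α - 1) - c) (neg_ne_zero.2 hk.ne')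
      (f := fun t => t ^ ((1 + α) / 2)) (fun t _ => ?_) ?_
      (Real.continuous_rpow_const hg0).continuousOn ?_ (incrementBound_rpow (by linarith) hg1)
    · simp only [gen, f₀]; ring
    · refine ((Real.concaveOn_rpow hg0 hg1).neg.smul hk.le).congr fun t _ => ?_
      simp
    · simp [gen, f₀]

/-- Every exponent is at least `-1/2`. The factor `1 / log 2 ^ 2` compensates for `log N`, which is
smallest at `N = 2`. -/
theorem inv_le_mul_rate_sq {D : Divergence} (hD : D.Admissible) {N : ℕ} (hN : 2 ≤ N) :
    1 / (N : ℝ) ≤ (1 + 1 / Real.log 2 ^ 2) * D.rate N ^ 2 := by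
  have hN1 : (1 : ℝ) ≤ N := by exact_mod_cast (by omega : 1 ≤ N)
  have hN2 : (2 : ℝ) ≤ N := by exact_mod_cast hN
  have hN0 : (0 : ℝ) < N := by linarith
  have hl2 : 0 < Real.log 2 := Real.log_pos (by norm_num)
  have hpow : ∀ e : ℝ, -(1 / 2) ≤ e → 1 / (N : ℝ) ≤ ((N : ℝ) ^ e) ^ 2 := by
    intro e he
    rw [← Real.rpow_natCast, ← Real.rpow_mul hN0.le, one_div, ← Real.rpow_neg_one]
    refine Real.rpow_le_rpow_of_exponent_le hN1 ?_
    push_cast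
    linarith
  have hsimple : ∀ e : ℝ, -(1 / 2) ≤ e →
      1 / (N : ℝ) ≤ (1 + 1 / Real.log 2 ^ 2) * ((N : ℝ) ^ e) ^ 2 := fun e he =>
    (hpow e he).trans (le_mul_of_one_le_left (sq_nonneg _) (by
      have : 0 ≤ 1 / Real.log 2 ^ 2 := by positivity
      linarith))
  have hlog : 1 / (N : ℝ) ≤
      (1 + 1 / Real.log 2 ^ 2) * ((N : ℝ) ^ (-(1 / 6) : ℝ) * Real.log N) ^ 2 := by
    have h1 : 1 ≤ (1 + 1 / Real.log 2 ^ 2) * Real.log N ^ 2 := by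
      calc (1 : ℝ) = 1 / Real.log 2 ^ 2 * Real.log 2 ^ 2 := by field_simp
        _ ≤ (1 + 1 / Real.log 2 ^ 2) * Real.log N ^ 2 := by
          gcongr
          linarith
    rw [mul_pow]
    calc 1 / (N : ℝ) ≤ ((N : ℝ) ^ (-(1 / 6) : ℝ)) ^ 2 * 1 := by
          rw [mul_one]; exact hpow _ (by norm_num)
      _ ≤ ((N : ℝ) ^ (-(1 / 6) : ℝ)) ^ 2 * ((1 + 1 / Real.log 2 ^ 2) * Real.log N ^ 2) := by gcongr
      _ = _ := by ring
  cases D with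
  | kl => exact hlog
  | tv => exact hsimple _ (by norm_num)
  | chiSq => exact hsimple _ (by norm_num)
  | js => exact hlog
  | fBeta β =>
    simp only [rate]
    split_ifs
    · exact hsimple _ (by norm_num)
    · exact hsimple _ (by norm_num)
  | fAlpha α =>
    obtain ⟨h13, h1⟩ := hD
    refine hsimple _ ?_
    rw [le_div_iff₀ (by linarith)]
    linarith

end Divergence

/-! ### Second moments and mean squared deviations. -/

section SecondMoments

variable {Ω : Type*} [MeasurableSpace Ω]

theorem memLp_two_of_lintegral_ne_top {τ : Measure Ω} {f : Ω → ℝ} (hf : AEStronglyMeasurable f τ)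
    (h : ∫⁻ w, ENNReal.ofReal (f w ^ 2) ∂τ ≠ ⊤) : MemLp f 2 τ := by
  rw [memLp_two_iff_integrable_sq hf]
  refine ⟨hf.pow 2, ?_⟩
  rw [hasFiniteIntegral_iff_ofReal (ae_of_all _ fun w => sq_nonneg _)]
  exact lt_top_iff_ne_top.2 h

theorem lintegral_ofReal_sq_eq {τ : Measure Ω} {f : Ω → ℝ} (hf : MemLp f 2 τ) :
    ∫⁻ w, ENNReal.ofReal (f w ^ 2) ∂τ = ENNReal.ofReal (∫ w, f w ^ 2 ∂τ) :=
  (ofReal_integral_eq_lintegral_ofReal hf.integrable_sq (ae_of_all _ fun _ => sq_nonneg _)).symm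

theorem integral_sq_sub_const (τ : Measure Ω) [IsProbabilityMeasure τ] {f : Ω → ℝ}
    (hf : MemLp f 2 τ) (c : ℝ) :
    ∫ w, (f w - c) ^ 2 ∂τ = variance f τ + (∫ w, f w ∂τ - c) ^ 2 := by
  have hc : MemLp (fun w => f w - c) 2 τ := hf.sub (memLp_const c)
  have h := variance_eq_sub hc
  rw [variance_sub_const hf.aestronglyMeasurable,
    integral_sub (hf.integrable (by norm_num)) (integrable_const c)] at h
  simp only [Pi.pow_apply, integral_const, probReal_univ, one_smul] at h
  linarith

theorem variance_le_integral_sq_sub (τ : Measure Ω) [IsProbabilityMeasure τ] {f : Ω → ℝ}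
    (hf : MemLp f 2 τ) (c : ℝ) : variance f τ ≤ ∫ w, (f w - c) ^ 2 ∂τ := by
  rw [integral_sq_sub_const τ hf]
  linarith [sq_nonneg (∫ w, f w ∂τ - c)]

theorem sq_integral_le (τ : Measure Ω) [IsProbabilityMeasure τ] {f : Ω → ℝ}
    (hf : MemLp f 2 τ) : (∫ w, f w ∂τ) ^ 2 ≤ ∫ w, f w ^ 2 ∂τ := by
  have h := variance_eq_sub hf
  simp only [Pi.pow_apply] at h
  linarith [variance_nonneg f τ]

end SecondMoments

/-! ### The Efron–Stein inequality. -/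

section EfronStein

variable {A B : Type*} [MeasurableSpace A] [MeasurableSpace B]

theorem ae_memLp_two_slice {ν : Measure A} [IsProbabilityMeasure ν] {ρ : Measure B}
    [IsProbabilityMeasure ρ] {g : A × B → ℝ} (hg : Measurable g) (h2 : MemLp g 2 (ν.prod ρ)) :
    ∀ᵐ b ∂ρ, MemLp (fun a => g (a, b)) 2 ν := by
  filter_upwards [h2.integrable_sq.prod_left_ae] with b hb
  exact (memLp_two_iff_integrable_sq
    (hg.comp measurable_prodMk_right).aestronglyMeasurable).2 hb

theorem memLp_two_integral_prod {ν : Measure A} [IsProbabilityMeasure ν] {ρ : Measure B}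
    [IsProbabilityMeasure ρ] {g : A × B → ℝ} (hg : Measurable g) (h2 : MemLp g 2 (ν.prod ρ)) :
    MemLp (fun b => ∫ a, g (a, b) ∂ν) 2 ρ := by
  have hm : StronglyMeasurable fun b => ∫ a, g (a, b) ∂ν :=
    hg.stronglyMeasurable.integral_prod_left'
  rw [memLp_two_iff_integrable_sq hm.aestronglyMeasurable]
  refine h2.integrable_sq.integral_prod_right.mono' (hm.aestronglyMeasurable.pow 2) ?_
  filter_upwards [ae_memLp_two_slice hg h2] with b hb
  rw [Real.norm_of_nonneg (sq_nonneg _)]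
  exact sq_integral_le ν hb

theorem integral_sq_integral_prod_le {ν : Measure A} [IsProbabilityMeasure ν] {ρ : Measure B}
    [IsProbabilityMeasure ρ] {g : A × B → ℝ} (hg : Measurable g) (h2 : MemLp g 2 (ν.prod ρ)) :
    ∫ b, (∫ a, g (a, b) ∂ν) ^ 2 ∂ρ ≤ ∫ w, g w ^ 2 ∂(ν.prod ρ) := by
  rw [integral_prod_symm _ h2.integrable_sq]
  refine integral_mono_ae (memLp_two_integral_prod hg h2).integrable_sq
    h2.integrable_sq.integral_prod_right ?_
  filter_upwards [ae_memLp_two_slice hg h2] with b hb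
  exact sq_integral_le ν hb

/-- Subadditivity of the variance over a product of two probability spaces. -/
theorem variance_prod_le {ν : Measure A} [IsProbabilityMeasure ν] {ρ : Measure B}
    [IsProbabilityMeasure ρ] {g : A × B → ℝ} (hg : Measurable g) (h2 : MemLp g 2 (ν.prod ρ))
    {G : A × B → ℝ} (hG : MemLp G 2 (ν.prod ρ)) (hconst : ∀ a a' b, G (a, b) = G (a', b)) :
    variance g (ν.prod ρ)
      ≤ ∫ w, (g w - G w) ^ 2 ∂(ν.prod ρ) + variance (fun b => ∫ a, g (a, b) ∂ν) ρ := by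
  have hbar := memLp_two_integral_prod hg h2
  have hd : MemLp (fun w => g w - G w) 2 (ν.prod ρ) := h2.sub hG
  have hv1 := variance_eq_sub h2
  have hv2 := variance_eq_sub hbar
  simp only [Pi.pow_apply] at hv1 hv2
  rw [integral_prod_symm _ (h2.integrable (by norm_num))] at hv1
  -- The left side is the mean conditional variance given `b`. On each slice `G` is constant, and
  -- the variance is the least mean squared deviation from a constant.
  have key : ∫ w, g w ^ 2 ∂(ν.prod ρ) - ∫ b, (∫ a, g (a, b) ∂ν) ^ 2 ∂ρ
      ≤ ∫ w, (g w - G w) ^ 2 ∂(ν.prod ρ) := by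
    rw [integral_prod_symm _ h2.integrable_sq, integral_prod_symm _ hd.integrable_sq,
      ← integral_sub h2.integrable_sq.integral_prod_right hbar.integrable_sq]
    refine integral_mono_ae (h2.integrable_sq.integral_prod_right.sub hbar.integrable_sq)
      hd.integrable_sq.integral_prod_right ?_
    filter_upwards [ae_memLp_two_slice hg h2] with b hb
    obtain ⟨a₀⟩ : Nonempty A := nonempty_of_isProbabilityMeasure ν
    have h := variance_le_integral_sq_sub ν hb (G (a₀, b))
    rw [variance_eq_sub hb] at h
    simp only [hconst _ a₀ b]
    exact h
  linarith

/-- The **Efron–Stein inequality**: the variance of a function of independent variables is at most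
the sum of its mean squared distances to functions ignoring one of the variables. -/
theorem variance_le_sum_integral_sq_sub {X : Type*} [MeasurableSpace X] (ν : Measure X)
    [IsProbabilityMeasure ν] (n : ℕ) (g : (Fin n → X) → ℝ) (hg : Measurable g)
    (h2 : MemLp g 2 (sampleLaw ν n)) (G : Fin n → (Fin n → X) → ℝ) (hG : ∀ i, Measurable (G i))
    (hG2 : ∀ i, MemLp (G i) 2 (sampleLaw ν n))
    (hupd : ∀ i x y, G i (Function.update x i y) = G i x) :
    variance g (sampleLaw ν n) ≤ ∑ i, ∫ x, (g x - G i x) ^ 2 ∂(sampleLaw ν n) := by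
  induction n with
  | zero =>
    have : g = fun _ => g default := by
      funext x
      rw [Subsingleton.elim x default]
    rw [this, variance_eq_sub (memLp_const _)]
    simp
  | succ n ih =>
    set e := (MeasurableEquiv.piFinSuccAbove (fun _ : Fin (n + 1) => X) 0).symm
    have hmp : MeasurePreserving e (ν.prod (sampleLaw ν n)) (sampleLaw ν (n + 1)) :=
      (measurePreserving_piFinSuccAbove (fun _ : Fin (n + 1) => ν) 0).symm
    have hcons : ∀ (a : X) (b : Fin n → X), e (a, b) = Fin.cons a b := by
      intro a b
      simp [e, MeasurableEquiv.piFinSuccAbove, Fin.insertNthEquiv]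
    have hint : ∀ k : (Fin (n + 1) → X) → ℝ,
        ∫ w, k (e w) ∂(ν.prod (sampleLaw ν n)) = ∫ x, k x ∂(sampleLaw ν (n + 1)) := fun k =>
      hmp.integral_comp e.measurableEmbedding k
    have hge : Measurable (g ∘ e) := hg.comp e.measurable
    have hge2 : MemLp (g ∘ e) 2 (ν.prod (sampleLaw ν n)) := h2.comp_measurePreserving hmp
    have hGe : ∀ i, Measurable (G i ∘ e) := fun i => (hG i).comp e.measurable
    have hGe2 : ∀ i, MemLp (G i ∘ e) 2 (ν.prod (sampleLaw ν n)) := fun i =>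
      (hG2 i).comp_measurePreserving hmp
    have hvar : variance (g ∘ e) (ν.prod (sampleLaw ν n)) = variance g (sampleLaw ν (n + 1)) :=
      hmp.variance_fun_comp hg.aemeasurable
    have hsplit := variance_prod_le hge hge2 (hGe2 0) (fun a a' b => by
      simp only [Function.comp_apply, hcons]
      rw [← Fin.update_cons_zero (α := fun _ => X) a b a', hupd])
    have hih := ih (fun b => ∫ a, (g ∘ e) (a, b) ∂ν)
      hge.stronglyMeasurable.integral_prod_left'.measurable (memLp_two_integral_prod hge hge2)
      (fun i b => ∫ a, (G i.succ ∘ e) (a, b) ∂ν)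
      (fun i => (hGe i.succ).stronglyMeasurable.integral_prod_left'.measurable)
      (fun i => memLp_two_integral_prod (hGe i.succ) (hGe2 i.succ))
      (fun i b y => by
        refine integral_congr_ae (ae_of_all _ fun a => ?_)
        simp only [Function.comp_apply, hcons]
        rw [Fin.cons_update, hupd])
    -- Averaging out the first coordinate does not increase the remaining terms, by Jensen's
    -- inequality for the square.
    have hstep : ∀ i : Fin n, ∫ b, ((∫ a, (g ∘ e) (a, b) ∂ν) - ∫ a, (G i.succ ∘ e) (a, b) ∂ν) ^ 2
        ∂(sampleLaw ν n) ≤ ∫ x, (g x - G i.succ x) ^ 2 ∂(sampleLaw ν (n + 1)) := by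
      intro i
      have hd := integral_sq_integral_prod_le (hge.sub (hGe i.succ)) (hge2.sub (hGe2 i.succ))
      rw [← hint fun x => (g x - G i.succ x) ^ 2]
      refine le_trans (le_of_eq (integral_congr_ae ?_)) hd
      filter_upwards [ae_memLp_two_slice hge hge2,
        ae_memLp_two_slice (hGe i.succ) (hGe2 i.succ)] with b h1 h3
      have := integral_sub (h1.integrable (by norm_num)) (h3.integrable (by norm_num))
      simp only [Pi.sub_apply]
      rw [this]
    rw [Fin.sum_univ_succ, ← hvar]
    refine hsplit.trans (add_le_add (le_of_eq ?_) (hih.trans (Finset.sum_le_sum fun i _ => hstep i)))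
    exact hint fun x => (g x - G 0 x) ^ 2

end EfronStein

/-! ### Splitting the variance of a conditionally i.i.d. average. -/

section MonteCarlo

variable {X Z : Type*} [MeasurableSpace X] [MeasurableSpace Z]

theorem integral_sq_average_sub_le (τ : Measure Z) [IsProbabilityMeasure τ] {h : Z → ℝ}
    (h2 : MemLp h 2 τ) {M : ℕ} (hM : 1 ≤ M) (c : ℝ) :
    MemLp (fun z : Fin M → Z => 1 / (M : ℝ) * ∑ m, h (z m)) 2 (Measure.pi fun _ => τ) ∧
    ∫ z, (1 / (M : ℝ) * ∑ m, h (z m) - c) ^ 2 ∂(Measure.pi fun _ : Fin M => τ)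
      ≤ 1 / (M : ℝ) * ∫ z, h z ^ 2 ∂τ + (∫ z, h z ∂τ - c) ^ 2 := by
  have hM0 : (0 : ℝ) < M := by exact_mod_cast hM
  have hm : ∀ m : Fin M, MemLp (fun z : Fin M → Z => h (z m)) 2 (Measure.pi fun _ => τ) :=
    fun m => h2.comp_measurePreserving (measurePreserving_eval (fun _ : Fin M => τ) m)
  have hT : MemLp (fun z : Fin M → Z => 1 / (M : ℝ) * ∑ m, h (z m)) 2
      (Measure.pi fun _ => τ) := (memLp_finsetSum _ fun m _ => hm m).const_mul _
  refine ⟨hT, ?_⟩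
  rw [integral_sq_sub_const _ hT, variance_const_mul, integral_const_mul,
    integral_finsetSum _ fun m _ => (hm m).integrable (by norm_num)]
  have hE : ∀ m : Fin M, ∫ z : Fin M → Z, h (z m) ∂(Measure.pi fun _ => τ) = ∫ z, h z ∂τ := by
    intro m
    have hmp := measurePreserving_eval (fun _ : Fin M => τ) m
    have e := integral_map hmp.measurable.aemeasurable (f := h)
      (by rw [hmp.map_eq]; exact h2.aestronglyMeasurable)
    rw [hmp.map_eq] at e
    exact e.symm
  have hV : variance (fun z : Fin M → Z => ∑ m, h (z m)) (Measure.pi fun _ => τ)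
      = M * variance h τ := by
    have := variance_sum_pi (μ := fun _ : Fin M => τ) (X := fun _ => h) fun _ => h2
    simp only [Finset.sum_const, Finset.card_univ, Fintype.card_fin, nsmul_eq_mul] at this
    rw [← this]
    congr 1
    funext z
    simp
  have hvle : variance h τ ≤ ∫ z, h z ^ 2 ∂τ := by
    simpa using variance_le_integral_sq_sub τ h2 0
  simp only [hE, Finset.sum_const, Finset.card_univ, Fintype.card_fin, nsmul_eq_mul]
  rw [hV, ← mul_assoc (1 / (M : ℝ)) (M : ℝ), one_div_mul_cancel hM0.ne', one_mul]
  have e : (1 / (M : ℝ)) ^ 2 * (M * variance h τ) = 1 / (M : ℝ) * variance h τ := by field_simp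
  rw [e]
  gcongr

/-- The variance of a conditionally i.i.d. average, split into the Monte-Carlo error and the
variance of the conditional mean `D`. -/
theorem variance_average_le (ν : Measure X) [IsProbabilityMeasure ν] (μ : Measure Z)
    [SigmaFinite μ] {N M : ℕ} (hM : 1 ≤ M) {pr : (Fin N → X) → Z → ℝ}
    (hm : Measurable (Function.uncurry pr)) (hd : ∀ x, IsDensity μ (pr x))
    {h : (Fin N → X) → Z → ℝ} (hh : Measurable (Function.uncurry h)) {K : ℝ} (hK : 0 ≤ K)
    (hhK : ∫⁻ x, ∫⁻ z, ENNReal.ofReal (h x z ^ 2) ∂(law μ (pr x)) ∂(sampleLaw ν N)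
      ≤ ENNReal.ofReal K)
    {D : (Fin N → X) → ℝ} (hDm : Measurable D)
    (hD : ∀ᵐ x ∂(sampleLaw ν N), D x = ∫ z, h x z ∂(law μ (pr x))) :
    MemLp (fun w : (Fin N → X) × (Fin M → Z) => 1 / (M : ℝ) * ∑ m, h w.1 (w.2 m)) 2
        (jointLaw ν μ pr M) ∧
      MemLp D 2 (sampleLaw ν N) ∧
      variance (fun w : (Fin N → X) × (Fin M → Z) => 1 / (M : ℝ) * ∑ m, h w.1 (w.2 m))
        (jointLaw ν μ pr M) ≤ 1 / (M : ℝ) * K + variance D (sampleLaw ν N) := by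
  have hM0 : (0 : ℝ) < M := by exact_mod_cast hM
  have := fun x => (hd x).isProbabilityMeasure_law
  have := isProbabilityMeasure_jointLaw ν μ (M := M) hm hd
  have hterm : ∀ m : Fin M, Measurable fun w : (Fin N → X) × (Fin M → Z) => h w.1 (w.2 m) :=
    fun m => hh.comp (f := fun w : (Fin N → X) × (Fin M → Z) => (w.1, w.2 m)) (by fun_prop)
  have hinner : Measurable fun x => ∫⁻ z, ENNReal.ofReal (h x z ^ 2) ∂(law μ (pr x)) := by
    have : ∀ x, ∫⁻ z, ENNReal.ofReal (h x z ^ 2) ∂(law μ (pr x))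
        = ∫⁻ z, ENNReal.ofReal (pr x z) * ENNReal.ofReal (h x z ^ 2) ∂μ := fun x =>
      lintegral_law (hd x).measurable ((hh.of_uncurry_left (x := x)).pow_const 2).ennreal_ofReal
    simp only [this]
    exact Measurable.lintegral_prod_right'
      (f := fun w : (Fin N → X) × Z => ENNReal.ofReal (pr w.1 w.2) * ENNReal.ofReal (h w.1 w.2 ^ 2))
      (hm.ennreal_ofReal.mul (hh.pow_const 2).ennreal_ofReal)
  have hslice : ∀ᵐ x ∂(sampleLaw ν N), MemLp (h x) 2 (law μ (pr x)) := by
    filter_upwards [ae_lt_top hinner (ne_top_of_le_ne_top ENNReal.ofReal_ne_top hhK)] with x hx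
    exact memLp_two_of_lintegral_ne_top hh.of_uncurry_left.aestronglyMeasurable hx.ne
  have hD2 : MemLp D 2 (sampleLaw ν N) := by
    refine memLp_two_of_lintegral_ne_top hDm.aestronglyMeasurable
      (ne_top_of_le_ne_top ENNReal.ofReal_ne_top (le_trans (lintegral_mono_ae ?_) hhK))
    filter_upwards [hD, hslice] with x hx hs
    rw [hx, lintegral_ofReal_sq_eq hs]
    exact ENNReal.ofReal_le_ofReal (sq_integral_le _ hs)
  -- The centre stays free because it is used twice: `c = 0` gives square-integrability, and the
  -- mean of `D` gives the variance bound.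
  have hbound : ∀ c : ℝ, ∫⁻ w : (Fin N → X) × (Fin M → Z),
      ENNReal.ofReal ((1 / (M : ℝ) * ∑ m, h w.1 (w.2 m) - c) ^ 2) ∂(jointLaw ν μ pr M)
      ≤ ENNReal.ofReal (1 / (M : ℝ) * K + ∫ x, (D x - c) ^ 2 ∂(sampleLaw ν N)) := by
    intro c
    have hDc : MemLp (fun x => D x - c) 2 (sampleLaw ν N) := hD2.sub (memLp_const c)
    rw [lintegral_jointLaw ν μ hm hd (by fun_prop),
      ENNReal.ofReal_add (by positivity) (integral_nonneg fun x => sq_nonneg _),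
      ENNReal.ofReal_mul (by positivity), ← lintegral_ofReal_sq_eq hDc]
    calc _ ≤ ∫⁻ x, (ENNReal.ofReal (1 / (M : ℝ)) *
            ∫⁻ z, ENNReal.ofReal (h x z ^ 2) ∂(law μ (pr x)) + ENNReal.ofReal ((D x - c) ^ 2))
            ∂(sampleLaw ν N) := by
          refine lintegral_mono_ae ?_
          filter_upwards [hD, hslice] with x hx hs
          obtain ⟨hT, hle⟩ := integral_sq_average_sub_le (law μ (pr x)) hs hM c
          have hTc : MemLp (fun z : Fin M → Z => 1 / (M : ℝ) * ∑ m, h x (z m) - c) 2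
            (Measure.pi fun _ => law μ (pr x)) := hT.sub (memLp_const c)
          rw [lintegral_ofReal_sq_eq hTc, lintegral_ofReal_sq_eq hs, hx,
            ← ENNReal.ofReal_mul (by positivity),
            ← ENNReal.ofReal_add (by positivity) (sq_nonneg _)]
          exact ENNReal.ofReal_le_ofReal hle
      _ ≤ _ := by
          rw [lintegral_add_left (hinner.const_mul _), lintegral_const_mul _ hinner]
          gcongr
  have hTm : AEStronglyMeasurable
      (fun w : (Fin N → X) × (Fin M → Z) => 1 / (M : ℝ) * ∑ m, h w.1 (w.2 m))
      (jointLaw ν μ pr M) := Measurable.aestronglyMeasurable (by fun_prop)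
  have hT2 : MemLp (fun w : (Fin N → X) × (Fin M → Z) => 1 / (M : ℝ) * ∑ m, h w.1 (w.2 m)) 2
      (jointLaw ν μ pr M) := by
    refine memLp_two_of_lintegral_ne_top hTm
      (ne_top_of_le_ne_top ENNReal.ofReal_ne_top (le_trans (le_of_eq ?_) (hbound 0)))
    simp
  refine ⟨hT2, hD2, (variance_le_integral_sq_sub _ hT2 (∫ x, D x ∂(sampleLaw ν N))).trans ?_⟩
  have hb := hbound (∫ x, D x ∂(sampleLaw ν N))
  rw [lintegral_ofReal_sq_eq (hT2.sub (memLp_const _) : MemLp (fun w => _ - _) 2 _),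
    ENNReal.ofReal_le_ofReal_iff (by
      have : 0 ≤ ∫ x, (D x - ∫ x, D x ∂(sampleLaw ν N)) ^ 2 ∂(sampleLaw ν N) :=
        integral_nonneg fun x => sq_nonneg _
      positivity)] at hb
  rwa [variance_eq_integral hDm.aemeasurable]

end MonteCarlo

/-! ### Moment bounds for mixtures, uniform in the number of components. -/

/-- The quadratic growth of a generator. -/
noncomputable def growth (f : ℝ → ℝ) (t : ℝ) : ℝ := 1 + t ^ 2 + f t ^ 2

theorem growth_nonneg (f : ℝ → ℝ) (t : ℝ) : 0 ≤ growth f t := by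
  unfold growth
  positivity

theorem RegularGenerator.measurable_comp {f : ℝ → ℝ} (hf : RegularGenerator f) {Ω : Type*}
    [MeasurableSpace Ω] {g : Ω → ℝ} (hg : Measurable g) (h0 : ∀ w, 0 ≤ g w) :
    Measurable fun w => f (g w) := by
  have hc : Continuous fun t => f (max 0 t) :=
    hf.continuousOn.comp_continuous (by fun_prop) fun t => mem_Ici.2 (le_max_left 0 t)
  have h := hc.measurable.comp hg
  simpa [Function.comp_def, max_eq_right (h0 _)] using h

theorem RegularGenerator.exists_line {f : ℝ → ℝ} (hf : RegularGenerator f) :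
    ∃ a : ℝ, ∀ t, 0 ≤ t → a * (t - 1) ≤ f t := by
  obtain ⟨a, ha⟩ := exists_supporting_line
    (hf.convexOn.subset Ioi_subset_Ici_self (convex_Ioi 0)) hf.map_one
  refine ⟨a, fun t ht => ?_⟩
  have hcl : Ici (0 : ℝ) ⊆ closure (Ioi 0) := by rw [closure_Ioi]
  exact ContinuousWithinAt.closure_le (f := fun t => a * (t - 1)) (g := f) (hcl ht)
    (by fun_prop) ((hf.continuousOn t ht).mono Ioi_subset_Ici_self) fun s hs => ha s hs

/-- The map `(v, r) ↦ v ^ 2 / r` is jointly convex, and the denominator on the left is the average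
of those on the right. It remains to bound `|f t|` by an average: Jensen bounds `f t` from above,
and a supporting line of slope `a` bounds it from below at the cost of `|a| * (u i + 1)`. -/
theorem exists_growth_div_average_le {f : ℝ → ℝ} (hf : RegularGenerator f) :
    ∃ C, 0 ≤ C ∧ ∀ r₀ r₁ : ℝ, ∀ N : ℕ, 1 ≤ N → ∀ u : Fin N → ℝ, (∀ i, 0 ≤ u i) →
      (∀ i, 0 < r₀ + r₁ * u i) →
      growth f (1 / (N : ℝ) * ∑ i, u i) / (r₀ + r₁ * (1 / (N : ℝ) * ∑ i, u i))
        ≤ C * (1 / (N : ℝ) * ∑ i, growth f (u i) / (r₀ + r₁ * u i)) := by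
  obtain ⟨a, ha⟩ := hf.exists_line
  refine ⟨4 + 3 * a ^ 2, by positivity, fun r₀ r₁ N hN u hu hr => ?_⟩
  have hN0 : (0 : ℝ) < N := by exact_mod_cast hN
  set t := 1 / (N : ℝ) * ∑ i, u i with ht
  have ht0 : 0 ≤ t := mul_nonneg (by positivity) (Finset.sum_nonneg fun i _ => hu i)
  have hrt : r₀ + r₁ * t = 1 / (N : ℝ) * ∑ i, (r₀ + r₁ * u i) := by
    rw [Finset.sum_add_distrib, ← Finset.mul_sum, ht]
    simp only [Finset.sum_const, Finset.card_univ, Fintype.card_fin, nsmul_eq_mul]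
    field_simp
  have hne : (Finset.univ : Finset (Fin N)).Nonempty := ⟨⟨0, hN⟩, Finset.mem_univ _⟩
  have hsum : 0 < ∑ i, (r₀ + r₁ * u i) := Finset.sum_pos (fun i _ => hr i) hne
  have hS : ∀ v : Fin N → ℝ, (1 / (N : ℝ) * ∑ i, v i) ^ 2 / (r₀ + r₁ * t)
      ≤ 1 / (N : ℝ) * ∑ i, v i ^ 2 / (r₀ + r₁ * u i) := by
    intro v
    rw [hrt]
    have e : (1 / (N : ℝ) * ∑ i, v i) ^ 2 / (1 / (N : ℝ) * ∑ i, (r₀ + r₁ * u i))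
        = 1 / (N : ℝ) * ((∑ i, v i) ^ 2 / ∑ i, (r₀ + r₁ * u i)) := by
      field_simp
    rw [e]
    gcongr
    exact Finset.sq_sum_div_le_sum_sq_div _ _ fun i _ => hr i
  have havg : ∀ d : ℝ, 1 / (N : ℝ) * ∑ _i : Fin N, d = d := by
    intro d
    simp only [Finset.sum_const, Finset.card_univ, Fintype.card_fin, nsmul_eq_mul]
    field_simp
  have hJ : f t ≤ 1 / (N : ℝ) * ∑ i, f (u i) := by
    have h := hf.convexOn.map_sum_le (t := Finset.univ) (w := fun _ : Fin N => 1 / (N : ℝ))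
      (p := u) (fun _ _ => by positivity) (by
        have := havg 1
        rwa [Finset.mul_sum, mul_one] at this) fun i _ => mem_Ici.2 (hu i)
    simp only [smul_eq_mul, ← Finset.mul_sum] at h
    exact h
  have habs : f t ^ 2 ≤ (1 / (N : ℝ) * ∑ i, (|f (u i)| + |a| * (u i + 1))) ^ 2 := by
    have e : 1 / (N : ℝ) * ∑ i, (|f (u i)| + |a| * (u i + 1))
        = 1 / (N : ℝ) * ∑ i, |f (u i)| + |a| * (t + 1) := by
      rw [Finset.sum_add_distrib, ← Finset.mul_sum, Finset.sum_add_distrib, mul_add]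
      have := havg 1
      rw [ht, mul_left_comm, mul_add, this]
    rw [e]
    have hp : 0 ≤ |a| * (t + 1) := mul_nonneg (abs_nonneg a) (by linarith)
    have hq : 0 ≤ 1 / (N : ℝ) * ∑ i, |f (u i)| :=
      mul_nonneg (by positivity) (Finset.sum_nonneg fun i _ => abs_nonneg _)
    have hle : 1 / (N : ℝ) * ∑ i, f (u i) ≤ 1 / (N : ℝ) * ∑ i, |f (u i)| := by
      gcongr
      exact le_abs_self _
    refine sq_le_sq' ?_ (by linarith)
    have h1 : -(|a| * (t + 1)) ≤ a * (t - 1) := by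
      have h2 : |a * (t - 1)| ≤ |a| * (t + 1) := by
        rw [abs_mul]
        gcongr
        rw [abs_le]
        constructor <;> linarith
      exact neg_le_of_abs_le h2
    linarith [ha t ht0]
  have hrt0 : 0 < r₀ + r₁ * t := by rw [hrt]; positivity
  have h1 := hS fun _ => 1
  rw [havg] at h1
  have h2 := hS u
  have h3 := hS fun i => |f (u i)| + |a| * (u i + 1)
  calc growth f t / (r₀ + r₁ * t)
      = 1 ^ 2 / (r₀ + r₁ * t) + t ^ 2 / (r₀ + r₁ * t) + f t ^ 2 / (r₀ + r₁ * t) := by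
        rw [growth]; ring
    _ ≤ 1 / (N : ℝ) * ∑ i, 1 ^ 2 / (r₀ + r₁ * u i) + 1 / (N : ℝ) * ∑ i, u i ^ 2 / (r₀ + r₁ * u i)
        + 1 / (N : ℝ) * ∑ i, (|f (u i)| + |a| * (u i + 1)) ^ 2 / (r₀ + r₁ * u i) := by
        refine add_le_add (add_le_add h1 h2) (le_trans ?_ h3)
        gcongr
    _ = 1 / (N : ℝ) * ∑ i, (1 ^ 2 + u i ^ 2 + (|f (u i)| + |a| * (u i + 1)) ^ 2)
          / (r₀ + r₁ * u i) := by
        rw [← mul_add, ← mul_add, ← Finset.sum_add_distrib, ← Finset.sum_add_distrib]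
        congr 1
        exact Finset.sum_congr rfl fun i _ => by rw [add_div, add_div]
    _ ≤ 1 / (N : ℝ) * ∑ i, (4 + 3 * a ^ 2) * (growth f (u i) / (r₀ + r₁ * u i)) := by
        gcongr with i
        rw [← mul_div_assoc]
        refine div_le_div_of_nonneg_right ?_ (hr i).le
        rw [growth, ← sq_abs (f (u i)), ← sq_abs a]
        nlinarith [sq_nonneg (|f (u i)| - |a| * u i), sq_nonneg (|f (u i)| - |a|),
          sq_nonneg (|a| * u i - |a|), sq_nonneg (a * |f (u i)|), sq_nonneg (|a| * |f (u i)|),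
          sq_nonneg (|f (u i)|), sq_nonneg (u i)]
    _ = (4 + 3 * a ^ 2) * (1 / (N : ℝ) * ∑ i, growth f (u i) / (r₀ + r₁ * u i)) := by
        rw [← Finset.mul_sum]; ring

theorem sq_lintegral_ofReal_le {Ω : Type*} [MeasurableSpace Ω] (τ : Measure Ω)
    [IsProbabilityMeasure τ] {w : Ω → ℝ} (hw : Measurable w) (h0 : ∀ x, 0 ≤ w x) :
    (∫⁻ x, ENNReal.ofReal (w x) ∂τ) ^ 2 ≤ ∫⁻ x, ENNReal.ofReal (w x ^ 2) ∂τ := by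
  by_cases h : ∫⁻ x, ENNReal.ofReal (w x ^ 2) ∂τ = ⊤
  · rw [h]; exact le_top
  have h2 := memLp_two_of_lintegral_ne_top hw.aestronglyMeasurable h
  rw [lintegral_ofReal_sq_eq h2, ← ofReal_integral_eq_lintegral_ofReal
    (h2.integrable (by norm_num)) (ae_of_all _ h0), ← ENNReal.ofReal_pow (integral_nonneg h0)]
  exact ENNReal.ofReal_le_ofReal (sq_integral_le τ h2)

/-- Likelihood ratios `s x` with respect to `P`, with a moment condition on the growth of the
generator relative to the weight `r₀ + r₁ t`. -/
structure RatioModel {X Z : Type*} [MeasurableSpace X] [MeasurableSpace Z] (f : ℝ → ℝ)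
    (ν : Measure X) (P : Measure Z) (s : X → Z → ℝ) (r₀ r₁ : ℝ) : Prop where
  measurable : Measurable (Function.uncurry s)
  nonneg : ∀ x z, 0 ≤ s x z
  lintegral_eq_one : ∀ᵐ x ∂ν, ∫⁻ z, ENNReal.ofReal (s x z) ∂P = 1
  r₀_le : r₀ ≤ 1
  r₁_le : r₁ ≤ 1
  pos : ∀ᵐ x ∂ν, ∀ᵐ z ∂P, 0 < r₀ + r₁ * s x z
  moment : ∫⁻ x, ∫⁻ z, ENNReal.ofReal (growth f (s x z) / (r₀ + r₁ * s x z)) ∂P ∂ν ≠ ⊤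

section Ratio

variable {X Z : Type*} [MeasurableSpace X] [MeasurableSpace Z] {f : ℝ → ℝ} {ν : Measure X}
  {P : Measure Z} {s : X → Z → ℝ} {r₀ r₁ : ℝ}

theorem ae_sampleLaw_of_ae [IsProbabilityMeasure ν] {N : ℕ} {p : X → Prop} (h : ∀ᵐ x ∂ν, p x) :
    ∀ᵐ x ∂(sampleLaw ν N), ∀ i, p (x i) :=
  ae_all_iff.2 fun i => (Measure.quasiMeasurePreserving_eval (fun _ : Fin N => ν) i).ae h

theorem RatioModel.mixture_nonneg (h : RatioModel f ν P s r₀ r₁) {N : ℕ} (x : Fin N → X) (z : Z) :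
    0 ≤ mixture s x z :=
  mul_nonneg (by positivity) (Finset.sum_nonneg fun i _ => h.nonneg (x i) z)

theorem RatioModel.ae_pos [IsProbabilityMeasure ν] (h : RatioModel f ν P s r₀ r₁) {N : ℕ} :
    ∀ᵐ x ∂(sampleLaw ν N), ∀ᵐ z ∂P, ∀ i, 0 < r₀ + r₁ * s (x i) z := by
  filter_upwards [ae_sampleLaw_of_ae h.pos] with x hx
  exact ae_all_iff.2 hx

theorem weight_mixture_pos {X Z : Type*} {s : X → Z → ℝ} {r₀ r₁ : ℝ} {N : ℕ} (hN : 1 ≤ N) {x : Fin N → X} {z : Z}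
    (hr : ∀ i, 0 < r₀ + r₁ * s (x i) z) : 0 < r₀ + r₁ * mixture s x z := by
  have hN0 : (0 : ℝ) < N := by exact_mod_cast hN
  have e : r₀ + r₁ * mixture s x z = 1 / (N : ℝ) * ∑ i, (r₀ + r₁ * s (x i) z) := by
    rw [Finset.sum_add_distrib, ← Finset.mul_sum, mixture]
    simp only [Finset.sum_const, Finset.card_univ, Fintype.card_fin, nsmul_eq_mul]
    field_simp
  rw [e]
  have : 0 < ∑ i, (r₀ + r₁ * s (x i) z) :=
    Finset.sum_pos (fun i _ => hr i) ⟨⟨0, hN⟩, Finset.mem_univ _⟩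
  positivity

/-- After the convexity bound each component has the same law, so averaging over the sample leaves
the single-component moment and `N` disappears. -/
theorem RatioModel.exists_lintegral_growth_mixture_le [IsProbabilityMeasure ν]
    [IsProbabilityMeasure P] (hf : RegularGenerator f) (h : RatioModel f ν P s r₀ r₁) :
    ∃ K : ℝ, 0 ≤ K ∧ ∀ N : ℕ, 1 ≤ N →
      ∫⁻ x, ∫⁻ z, ENNReal.ofReal (growth f (mixture s x z) / (r₀ + r₁ * mixture s x z)) ∂P
        ∂(sampleLaw ν N) ≤ ENNReal.ofReal K := by
  obtain ⟨C, hC, H⟩ := exists_growth_div_average_le hf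
  set S : X → ℝ≥0∞ := fun x =>
    ∫⁻ z, ENNReal.ofReal (growth f (s x z) / (r₀ + r₁ * s x z)) ∂P
  have hfs : Measurable fun w : X × Z => f (s w.1 w.2) :=
    hf.measurable_comp h.measurable fun w => h.nonneg w.1 w.2
  have hsm : Measurable fun w : X × Z => s w.1 w.2 := h.measurable
  have hgm : Measurable fun w : X × Z => growth f (s w.1 w.2) / (r₀ + r₁ * s w.1 w.2) :=
    ((measurable_const.add (hsm.pow_const 2)).add (hfs.pow_const 2)).div
      (measurable_const.add (hsm.const_mul r₁))
  have hS : Measurable S := Measurable.lintegral_prod_right' hgm.ennreal_ofReal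
  refine ⟨C * (∫⁻ x, S x ∂ν).toReal, by positivity, fun N hN => ?_⟩
  have hN0 : (0 : ℝ) < N := by exact_mod_cast hN
  calc _ ≤ ∫⁻ x, ENNReal.ofReal C * (ENNReal.ofReal (1 / (N : ℝ)) * ∑ i, S (x i))
          ∂(sampleLaw ν N) := by
        refine lintegral_mono_ae ?_
        filter_upwards [h.ae_pos (N := N)] with x hx
        have hxm : ∀ i, Measurable fun z =>
            ENNReal.ofReal (growth f (s (x i) z) / (r₀ + r₁ * s (x i) z)) := fun i =>
          (hgm.comp (measurable_prodMk_left (x := x i))).ennreal_ofReal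
        calc _ ≤ ∫⁻ z, ENNReal.ofReal C * (ENNReal.ofReal (1 / (N : ℝ)) *
                ∑ i, ENNReal.ofReal (growth f (s (x i) z) / (r₀ + r₁ * s (x i) z))) ∂P := by
              refine lintegral_mono_ae ?_
              filter_upwards [hx] with z hz
              rw [← ENNReal.ofReal_sum_of_nonneg fun i _ =>
                  div_nonneg (growth_nonneg _ _) (hz i).le,
                ← ENNReal.ofReal_mul (by positivity), ← ENNReal.ofReal_mul hC]
              exact ENNReal.ofReal_le_ofReal (H r₀ r₁ N hN _ (fun i => h.nonneg _ z) hz)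
          _ = _ := by
              rw [lintegral_const_mul _ (by fun_prop), lintegral_const_mul _ (by fun_prop),
                lintegral_finsetSum _ fun i _ => hxm i]
    _ = ENNReal.ofReal (C * (∫⁻ x, S x ∂ν).toReal) := by
        have hev : ∀ i : Fin N, ∫⁻ x, S (x i) ∂(sampleLaw ν N) = ∫⁻ x, S x ∂ν := fun i =>
          (measurePreserving_eval (fun _ : Fin N => ν) i).lintegral_comp hS
        rw [lintegral_const_mul _ (by fun_prop), lintegral_const_mul _ (by fun_prop),
          lintegral_finsetSum _ fun i _ => by fun_prop]
        simp only [hev, Finset.sum_const, Finset.card_univ, Fintype.card_fin, nsmul_eq_mul]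
        rw [← mul_assoc (ENNReal.ofReal (1 / (N : ℝ))), ← ENNReal.ofReal_natCast,
          ← ENNReal.ofReal_mul (by positivity), one_div_mul_cancel hN0.ne', ENNReal.ofReal_one,
          one_mul, ENNReal.ofReal_mul hC, ENNReal.ofReal_toReal h.moment]

end Ratio

/-! ### The variance of the RAM estimator, by deleting components. -/

section ConditionalMean

variable {X Z : Type*} [MeasurableSpace X] [MeasurableSpace Z] {f : ℝ → ℝ} {ν : Measure X}
  {P : Measure Z} {s : X → Z → ℝ} {r₀ r₁ : ℝ}

/-- The mixture with its `i`-th component deleted. -/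
noncomputable def mixtureErase {X Z : Type*} (s : X → Z → ℝ) {N : ℕ} (i : Fin N) (x : Fin N → X) (z : Z) : ℝ :=
  (1 / (N : ℝ)) * ∑ j ∈ Finset.univ.erase i, s (x j) z

theorem mixtureErase_eq {X Z : Type*} (s : X → Z → ℝ) {N : ℕ} (i : Fin N) (x : Fin N → X) (z : Z) :
    mixtureErase s i x z = mixture s x z - 1 / (N : ℝ) * s (x i) z := by
  rw [mixtureErase, mixture, ← Finset.add_sum_erase _ _ (Finset.mem_univ i)]
  ring

theorem mixtureErase_update {X Z : Type*} (s : X → Z → ℝ) {N : ℕ} (i : Fin N) (x : Fin N → X)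
    (y : X) (z : Z) : mixtureErase s i (Function.update x i y) z = mixtureErase s i x z := by
  unfold mixtureErase
  congr 1
  refine Finset.sum_congr rfl fun j hj => ?_
  rw [Function.update_of_ne (Finset.ne_of_mem_erase hj)]

theorem RatioModel.mixtureErase_nonneg (h : RatioModel f ν P s r₀ r₁) {N : ℕ} (i : Fin N)
    (x : Fin N → X) (z : Z) : 0 ≤ mixtureErase s i x z :=
  mul_nonneg (by positivity) (Finset.sum_nonneg fun j _ => h.nonneg (x j) z)

theorem RatioModel.measurable_comp_mixture (hf : RegularGenerator f)
    (h : RatioModel f ν P s r₀ r₁) (N : ℕ) :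
    Measurable (Function.uncurry fun (x : Fin N → X) z => f (mixture s x z)) :=
  hf.measurable_comp (measurable_mixture h.measurable N) fun w => h.mixture_nonneg w.1 w.2

theorem RatioModel.measurable_comp_mixtureErase (hf : RegularGenerator f)
    (h : RatioModel f ν P s r₀ r₁) {N : ℕ} (i : Fin N) :
    Measurable (Function.uncurry fun (x : Fin N → X) z => f (mixtureErase s i x z)) := by
  refine hf.measurable_comp (g := fun w : (Fin N → X) × Z => mixtureErase s i w.1 w.2) ?_
    fun w => h.mixtureErase_nonneg i w.1 w.2
  have hj : ∀ j : Fin N, Measurable fun w : (Fin N → X) × Z => s (w.1 j) w.2 := fun j =>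
    h.measurable.comp (f := fun w : (Fin N → X) × Z => (w.1 j, w.2)) (by fun_prop)
  exact (Finset.measurable_sum _ fun j _ => hj j).const_mul _

/-- For fixed samples, the squared effects of deleting one component add up to `O(1 / N)`. -/
theorem RatioModel.sum_sq_integral_sub_le [IsProbabilityMeasure P] (hf : RegularGenerator f)
    (h : RatioModel f ν P s r₀ r₁) {C : ℝ} (hC : 0 ≤ C)
    (hinc : ∀ t h, 0 ≤ h → h ≤ t →
      (t + t ^ 2) * (f t - f (t - h)) ^ 2 ≤ C * h ^ 2 * (1 + t ^ 2 + f t ^ 2))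
    {N : ℕ} (hN : 1 ≤ N) {x : Fin N → X}
    (h1 : ∀ i, ∫⁻ z, ENNReal.ofReal (s (x i) z) ∂P = 1)
    (hr : ∀ᵐ z ∂P, ∀ i, 0 < r₀ + r₁ * s (x i) z)
    (hfin : ∫⁻ z, ENNReal.ofReal (growth f (mixture s x z) / (r₀ + r₁ * mixture s x z)) ∂P ≠ ⊤) :
    ∑ i, ENNReal.ofReal
        ((∫ z, f (mixture s x z) ∂P - ∫ z, f (mixtureErase s i x z) ∂P) ^ 2)
      ≤ ENNReal.ofReal (C / N) *
        ∫⁻ z, ENNReal.ofReal (growth f (mixture s x z) / (r₀ + r₁ * mixture s x z)) ∂P := by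
  have hN0 : (0 : ℝ) < N := by exact_mod_cast hN
  set t : Z → ℝ := mixture s x with ht
  have htm : Measurable t := (measurable_mixture h.measurable N).of_uncurry_left
  have ht0 : ∀ z, 0 ≤ t z := fun z => h.mixture_nonneg x z
  have hsm : ∀ i, Measurable (s (x i)) := fun i => h.measurable.of_uncurry_left
  have hs0 : ∀ i z, 0 ≤ s (x i) z := fun i z => h.nonneg (x i) z
  have hfm : Measurable fun z => f (t z) := hf.measurable_comp htm ht0
  have hgm : Measurable fun z => growth f (t z) :=
    (measurable_const.add (htm.pow_const 2)).add (hfm.pow_const 2)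
  have hgrm : Measurable fun z => growth f (t z) / (r₀ + r₁ * t z) :=
    hgm.div (measurable_const.add (htm.const_mul r₁))
  have hsum : ∀ z, ∑ i, s (x i) z = N * t z := by
    intro z
    simp only [ht, mixture]
    field_simp
  have hle : ∀ i z, 1 / (N : ℝ) * s (x i) z ≤ t z := by
    intro i z
    simp only [ht, mixture]
    gcongr
    exact Finset.single_le_sum (fun j _ => hs0 j z) (Finset.mem_univ i)
  -- The increment bound divided by `t + t ^ 2`: deleting component `i` changes `f` by at most `s (x
  -- i) z / N` times `√(W z)`. Where `t z = 0`, that component vanishes and nothing changes.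
  set W : Z → ℝ := fun z => C * (growth f (t z) / (t z + t z ^ 2))
  have hWm : Measurable W := (hgm.div (htm.add (htm.pow_const 2))).const_mul C
  have hW0 : ∀ z, 0 ≤ W z := fun z => mul_nonneg hC
    (div_nonneg (growth_nonneg _ _) (add_nonneg (ht0 z) (sq_nonneg _)))
  set w : Z → ℝ := fun z => √(W z)
  have hwm : Measurable w := hWm.sqrt
  have hw0 : ∀ z, 0 ≤ w z := fun z => Real.sqrt_nonneg _
  have hdiff : ∀ i z, |f (t z) - f (mixtureErase s i x z)| ≤ 1 / (N : ℝ) * (s (x i) z * w z) := by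
    intro i z
    rw [mixtureErase_eq]
    rcases (ht0 z).eq_or_lt' with h0 | hpos
    · have hz : 1 / (N : ℝ) * s (x i) z = 0 :=
        le_antisymm ((hle i z).trans h0.le) (mul_nonneg (by positivity) (hs0 i z))
      rw [← mul_assoc, hz]
      simp [t]
    · have hi := hinc (t z) (1 / (N : ℝ) * s (x i) z) (mul_nonneg (by positivity) (hs0 i z))
        (hle i z)
      rw [← mul_assoc]
      refine abs_le_of_sq_le_sq ?_ (mul_nonneg (mul_nonneg (by positivity) (hs0 i z)) (hw0 z))
      rw [mul_pow, Real.sq_sqrt (hW0 z)]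
      have hden : 0 < t z + t z ^ 2 := by positivity
      have e : (1 / (N : ℝ) * s (x i) z) ^ 2 * W z
          = C * (1 / (N : ℝ) * s (x i) z) ^ 2 * growth f (t z) / (t z + t z ^ 2) := by
        simp only [W]; ring
      rw [e, le_div_iff₀ hden, mul_comm]
      exact hi
  -- The factor `t` cancels against `t + t ^ 2`, leaving `1 + t`, which dominates `r₀ + r₁ * t`
  -- because both coefficients are at most one.
  have hWle : ∀ᵐ z ∂P, t z * W z ≤ C * (growth f (t z) / (r₀ + r₁ * t z)) := by
    filter_upwards [hr] with z hz
    have hrz : 0 < r₀ + r₁ * t z := weight_mixture_pos hN hz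
    rcases (ht0 z).eq_or_lt' with h0 | hpos
    · rw [h0, zero_mul]
      rw [h0] at hrz
      exact mul_nonneg hC (div_nonneg (growth_nonneg _ _) hrz.le)
    · have e : t z * W z = C * (growth f (t z) / (1 + t z)) := by
        simp only [W]; field_simp
      rw [e]
      refine mul_le_mul_of_nonneg_left ?_ hC
      refine div_le_div_of_nonneg_left (growth_nonneg _ _) hrz ?_
      have := mul_le_mul_of_nonneg_right h.r₁_le (ht0 z)
      linarith [h.r₀_le]
  -- Cauchy–Schwarz is applied under the probability measure with density `s (x i)`, so the ratio
  -- itself appears on the right only to the first power.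
  have hCS : ∀ i, (∫⁻ z, ENNReal.ofReal (s (x i) z * w z) ∂P) ^ 2
      ≤ ∫⁻ z, ENNReal.ofReal (s (x i) z * W z) ∂P := by
    intro i
    have hprob : IsProbabilityMeasure (P.withDensity fun z => ENNReal.ofReal (s (x i) z)) :=
      ⟨by rw [withDensity_apply _ MeasurableSet.univ, Measure.restrict_univ]; exact h1 i⟩
    have hcs := sq_lintegral_ofReal_le (P.withDensity fun z => ENNReal.ofReal (s (x i) z)) hwm hw0
    rw [lintegral_withDensity_eq_lintegral_mul _ (hsm i).ennreal_ofReal hwm.ennreal_ofReal,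
      lintegral_withDensity_eq_lintegral_mul _ (hsm i).ennreal_ofReal
        (hwm.pow_const 2).ennreal_ofReal] at hcs
    simp only [Pi.mul_apply, ← ENNReal.ofReal_mul (hs0 i _)] at hcs
    simpa only [w, Real.sq_sqrt (hW0 _)] using hcs
  -- The components sum to `N * t`: one factor `N` against the `1 / N ^ 2` of the squared increments
  -- is what yields the rate `1 / N`.
  have htot : ∑ i, ∫⁻ z, ENNReal.ofReal (s (x i) z * W z) ∂P
      ≤ ENNReal.ofReal (C * N) *
        ∫⁻ z, ENNReal.ofReal (growth f (t z) / (r₀ + r₁ * t z)) ∂P := by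
    have hsW : ∀ i, Measurable fun z => ENNReal.ofReal (s (x i) z * W z) := fun i =>
      ((hsm i).mul hWm).ennreal_ofReal
    rw [← lintegral_finsetSum _ fun i _ => hsW i, ← lintegral_const_mul _ hgrm.ennreal_ofReal]
    refine lintegral_mono_ae ?_
    filter_upwards [hWle] with z hz
    rw [← ENNReal.ofReal_sum_of_nonneg fun i _ => mul_nonneg (hs0 i z) (hW0 z), ← Finset.sum_mul,
      hsum, ← ENNReal.ofReal_mul (by positivity)]
    refine ENNReal.ofReal_le_ofReal ?_
    calc (N : ℝ) * t z * W z = N * (t z * W z) := by ring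
      _ ≤ N * (C * (growth f (t z) / (r₀ + r₁ * t z))) := by gcongr
      _ = C * N * (growth f (t z) / (r₀ + r₁ * t z)) := by ring
  have hfin_tot := ne_top_of_le_ne_top (ENNReal.mul_ne_top ENNReal.ofReal_ne_top hfin) htot
  have hfin_i : ∀ i, ∫⁻ z, ENNReal.ofReal (s (x i) z * W z) ∂P ≠ ⊤ := fun i =>
    ne_top_of_le_ne_top hfin_tot (Finset.single_le_sum
      (f := fun i => ∫⁻ z, ENNReal.ofReal (s (x i) z * W z) ∂P) (fun _ _ => zero_le)
      (Finset.mem_univ i))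
  have hint_sw : ∀ i, Integrable (fun z => s (x i) z * w z) P := by
    intro i
    refine ⟨((hsm i).mul hwm).aestronglyMeasurable, ?_⟩
    rw [hasFiniteIntegral_iff_ofReal (ae_of_all _ fun z => mul_nonneg (hs0 i z) (hw0 z))]
    refine lt_top_iff_ne_top.2 fun htop => hfin_i i ?_
    have := hCS i
    rw [htop] at this
    simpa using this
  have hint_s : ∀ i, Integrable (s (x i)) P := by
    intro i
    refine ⟨(hsm i).aestronglyMeasurable, ?_⟩
    rw [hasFiniteIntegral_iff_ofReal (ae_of_all _ fun z => hs0 i z), h1 i]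
    exact ENNReal.one_lt_top
  have hint_t : Integrable t P := (integrable_finsetSum _ fun i _ => hint_s i).const_mul _
  have hint_g : Integrable (fun z => growth f (t z) / (r₀ + r₁ * t z)) P := by
    refine ⟨hgrm.aestronglyMeasurable, ?_⟩
    rw [hasFiniteIntegral_iff_ofReal]
    · exact lt_top_iff_ne_top.2 hfin
    · filter_upwards [hr] with z hz
      exact div_nonneg (growth_nonneg _ _) (weight_mixture_pos hN hz).le
  -- For `r = r₀ + r₁ * t`, `|f| ≤ f ^ 2 / r + r`, and `r ≤ 1 + t` is integrable.
  have hint_f : Integrable (fun z => f (t z)) P := by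
    refine (hint_g.add ((integrable_const 1).add hint_t)).mono' hfm.aestronglyMeasurable ?_
    filter_upwards [hr] with z hz
    have hrz : 0 < r₀ + r₁ * t z := weight_mixture_pos hN hz
    have hr1 : r₀ + r₁ * t z ≤ 1 + t z := by
      have := mul_le_mul_of_nonneg_right h.r₁_le (ht0 z)
      linarith [h.r₀_le]
    simp only [Pi.add_apply, Real.norm_eq_abs]
    refine le_trans ?_ (add_le_add_right hr1 _)
    rw [← sub_le_iff_le_add, le_div_iff₀ hrz, growth, ← sq_abs (f (t z))]
    nlinarith [sq_nonneg (|f (t z)| - (r₀ + r₁ * t z)), sq_nonneg (t z),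
      sq_nonneg (|f (t z)|), sq_nonneg (r₀ + r₁ * t z), abs_nonneg (f (t z))]
  have hfem : ∀ i, Measurable fun z => f (mixtureErase s i x z) := fun i =>
    (h.measurable_comp_mixtureErase hf i).of_uncurry_left
  have hint_d : ∀ i, Integrable (fun z => f (t z) - f (mixtureErase s i x z)) P := fun i =>
    ((hint_sw i).const_mul (1 / (N : ℝ))).mono' (hfm.sub (hfem i)).aestronglyMeasurable
      (ae_of_all _ fun z => hdiff i z)
  have hint_fe : ∀ i, Integrable (fun z => f (mixtureErase s i x z)) P := fun i => by
    have := hint_f.sub (hint_d i)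
    refine this.congr (ae_of_all _ fun z => ?_)
    simp
  have hterm : ∀ i, ENNReal.ofReal
      ((∫ z, f (t z) ∂P - ∫ z, f (mixtureErase s i x z) ∂P) ^ 2)
      ≤ ENNReal.ofReal (1 / (N : ℝ) ^ 2) * ∫⁻ z, ENNReal.ofReal (s (x i) z * W z) ∂P := by
    intro i
    have hb : |∫ z, f (t z) ∂P - ∫ z, f (mixtureErase s i x z) ∂P|
        ≤ 1 / (N : ℝ) * ∫ z, s (x i) z * w z ∂P := by
      rw [← integral_sub hint_f (hint_fe i), ← integral_const_mul]
      exact abs_integral_le_integral_abs.trans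
        (integral_mono (hint_d i).abs ((hint_sw i).const_mul _) fun z => hdiff i z)
    calc _ ≤ ENNReal.ofReal ((1 / (N : ℝ) * ∫ z, s (x i) z * w z ∂P) ^ 2) := by
          refine ENNReal.ofReal_le_ofReal ?_
          rw [← sq_abs]
          gcongr
      _ = ENNReal.ofReal (1 / (N : ℝ) ^ 2) * (∫⁻ z, ENNReal.ofReal (s (x i) z * w z) ∂P) ^ 2 := by
          rw [← ofReal_integral_eq_lintegral_ofReal (hint_sw i)
              (ae_of_all _ fun z => mul_nonneg (hs0 i z) (hw0 z)),
            ← ENNReal.ofReal_pow (integral_nonneg fun z => mul_nonneg (hs0 i z) (hw0 z)),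
            ← ENNReal.ofReal_mul (by positivity), mul_pow, one_div, one_div, inv_pow]
      _ ≤ _ := by
          gcongr
          exact hCS i
  calc _ ≤ ∑ i, ENNReal.ofReal (1 / (N : ℝ) ^ 2) *
          ∫⁻ z, ENNReal.ofReal (s (x i) z * W z) ∂P := Finset.sum_le_sum fun i _ => hterm i
    _ = ENNReal.ofReal (1 / (N : ℝ) ^ 2) * ∑ i, ∫⁻ z, ENNReal.ofReal (s (x i) z * W z) ∂P :=
        (Finset.mul_sum _ _ _).symm
    _ ≤ ENNReal.ofReal (1 / (N : ℝ) ^ 2) * (ENNReal.ofReal (C * N) *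
          ∫⁻ z, ENNReal.ofReal (growth f (t z) / (r₀ + r₁ * t z)) ∂P) := by gcongr
    _ = _ := by
        rw [← mul_assoc, ← ENNReal.ofReal_mul (by positivity)]
        congr 2
        field_simp

theorem RatioModel.measurable_lintegral_growth (hf : RegularGenerator f)
    (h : RatioModel f ν P s r₀ r₁) [SFinite P] (N : ℕ) :
    Measurable fun x : Fin N → X =>
      ∫⁻ z, ENNReal.ofReal (growth f (mixture s x z) / (r₀ + r₁ * mixture s x z)) ∂P := by
  have htm : Measurable fun w : (Fin N → X) × Z => mixture s w.1 w.2 :=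
    measurable_mixture h.measurable N
  have hfm : Measurable fun w : (Fin N → X) × Z => f (mixture s w.1 w.2) :=
    h.measurable_comp_mixture hf N
  have hgm : Measurable fun w : (Fin N → X) × Z =>
      growth f (mixture s w.1 w.2) / (r₀ + r₁ * mixture s w.1 w.2) :=
    ((measurable_const.add (htm.pow_const 2)).add (hfm.pow_const 2)).div
      (measurable_const.add (htm.const_mul r₁))
  exact Measurable.lintegral_prod_right' hgm.ennreal_ofReal

/-- The variance of the random mixture estimator is `O(1 / N)`. -/
theorem RatioModel.variance_integral_mixture_le [IsProbabilityMeasure ν] [IsProbabilityMeasure P]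
    (hf : RegularGenerator f) (h : RatioModel f ν P s r₀ r₁) :
    ∃ K : ℝ, 0 ≤ K ∧ ∀ N : ℕ, 1 ≤ N →
      MemLp (fun x : Fin N → X => ∫ z, f (mixture s x z) ∂P) 2 (sampleLaw ν N) →
      variance (fun x : Fin N → X => ∫ z, f (mixture s x z) ∂P) (sampleLaw ν N)
        ≤ K * (1 / (N : ℝ)) := by
  obtain ⟨C, hC, hinc⟩ := hf.increment
  obtain ⟨K, hK, hmom⟩ := h.exists_lintegral_growth_mixture_le hf
  refine ⟨C * K, by positivity, fun N hN hD2 => ?_⟩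
  have hN0 : (0 : ℝ) < N := by exact_mod_cast hN
  have hAm := h.measurable_lintegral_growth hf N
  have hDm : Measurable fun x : Fin N → X => ∫ z, f (mixture s x z) ∂P :=
    (h.measurable_comp_mixture hf N).stronglyMeasurable.integral_prod_right.measurable
  have hGm : ∀ i : Fin N, Measurable fun x : Fin N → X => ∫ z, f (mixtureErase s i x z) ∂P :=
    fun i => (h.measurable_comp_mixtureErase hf i).stronglyMeasurable.integral_prod_right.measurable
  have hsum : ∑ i : Fin N, ∫⁻ x, ENNReal.ofReal
      ((∫ z, f (mixture s x z) ∂P - ∫ z, f (mixtureErase s i x z) ∂P) ^ 2) ∂(sampleLaw ν N)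
      ≤ ENNReal.ofReal (C / N * K) := by
    have hdm : ∀ i : Fin N, Measurable fun x : Fin N → X => ENNReal.ofReal
        ((∫ z, f (mixture s x z) ∂P - ∫ z, f (mixtureErase s i x z) ∂P) ^ 2) := fun i =>
      ((hDm.sub (hGm i)).pow_const 2).ennreal_ofReal
    rw [← lintegral_finsetSum _ fun i _ => hdm i, ENNReal.ofReal_mul (by positivity)]
    refine le_trans ?_ (mul_le_mul_right (hmom N hN) _)
    rw [← lintegral_const_mul _ hAm]
    refine lintegral_mono_ae ?_
    filter_upwards [ae_sampleLaw_of_ae h.lintegral_eq_one, h.ae_pos (N := N),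
      ae_lt_top hAm (ne_top_of_le_ne_top ENNReal.ofReal_ne_top (hmom N hN))] with x h1 hr hfin
    exact h.sum_sq_integral_sub_le hf hC hinc hN h1 hr hfin.ne
  have hd2 : ∀ i : Fin N, MemLp (fun x : Fin N → X =>
      ∫ z, f (mixture s x z) ∂P - ∫ z, f (mixtureErase s i x z) ∂P) 2 (sampleLaw ν N) := fun i =>
    memLp_two_of_lintegral_ne_top (hDm.sub (hGm i)).aestronglyMeasurable
      (ne_top_of_le_ne_top ENNReal.ofReal_ne_top (le_trans (Finset.single_le_sum
        (f := fun i : Fin N => ∫⁻ x, ENNReal.ofReal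
          ((∫ z, f (mixture s x z) ∂P - ∫ z, f (mixtureErase s i x z) ∂P) ^ 2) ∂(sampleLaw ν N))
        (fun _ _ => zero_le) (Finset.mem_univ i)) hsum))
  -- The summed bound makes the deletion effects square-integrable; subtracting them from the full
  -- estimator gives the integrability Efron–Stein requires.
  have hG2 : ∀ i : Fin N, MemLp (fun x : Fin N → X => ∫ z, f (mixtureErase s i x z) ∂P) 2
      (sampleLaw ν N) := fun i => by
    have := hD2.sub (hd2 i)
    refine this.ae_eq (ae_of_all _ fun x => ?_)
    simp
  have hES := variance_le_sum_integral_sq_sub ν N _ hDm hD2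
    (fun i x => ∫ z, f (mixtureErase s i x z) ∂P) hGm hG2 (fun i x y => by
      simp only [mixtureErase_update])
  refine hES.trans ?_
  have hR : ENNReal.ofReal (∑ i : Fin N, ∫ x,
      (∫ z, f (mixture s x z) ∂P - ∫ z, f (mixtureErase s i x z) ∂P) ^ 2 ∂(sampleLaw ν N))
      ≤ ENNReal.ofReal (C / N * K) := by
    rw [ENNReal.ofReal_sum_of_nonneg fun i _ => integral_nonneg fun x => sq_nonneg _]
    refine le_trans (le_of_eq (Finset.sum_congr rfl fun i _ => ?_)) hsum
    exact (lintegral_ofReal_sq_eq (hd2 i)).symm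
  rw [ENNReal.ofReal_le_ofReal_iff (by positivity)] at hR
  refine hR.trans (le_of_eq ?_)
  ring

end ConditionalMean

/-- Continuity at zero from the right identifies the limit with the value that the formula takes at
`0`. -/
theorem RegularGenerator.extendZero_eq {f : ℝ → ℝ} (hf : RegularGenerator f) {t : ℝ}
    (ht : 0 ≤ t) : extendZero f t = (f t : EReal) := by
  unfold extendZero
  split_ifs with h
  · rfl
  · obtain rfl : t = 0 := le_antisymm (not_lt.1 h) ht
    have hlim : Tendsto f (𝓝[>] 0) (𝓝 (f 0)) :=
      (hf.continuousOn 0 (mem_Ici.2 le_rfl)).mono_left (nhdsWithin_mono _ Ioi_subset_Ici_self)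
    exact ((continuous_coe_real_ereal.tendsto _).comp hlim).liminf_eq

theorem ereal_coe_sum {ι : Type*} (s : Finset ι) (f : ι → ℝ) :
    ∑ i ∈ s, ((f i : ℝ) : EReal) = ((∑ i ∈ s, f i : ℝ) : EReal) := by
  classical
  induction s using Finset.induction_on with
  | empty => simp
  | insert i s hi ih => rw [Finset.sum_insert hi, Finset.sum_insert hi, ih, EReal.coe_add]

theorem mixture_div {X Z : Type*} (q : X → Z → ℝ) (p : Z → ℝ) {N : ℕ} (x : Fin N → X) (z : Z) :
    mixture q x z / p z = mixture (fun x z => q x z / p z) x z := by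
  rw [mixture, mixture, mul_div_assoc, Finset.sum_div]

/-! ### From ratio models to the variance bound. -/

section Assembly

variable {X Z : Type*} [MeasurableSpace X] [MeasurableSpace Z]

theorem toReal_ramMC {X Z : Type*} {f : ℝ → ℝ} (hf : RegularGenerator f) {p : Z → ℝ}
    {q : X → Z → ℝ} (h0 : ∀ x z, 0 ≤ q x z / p z) {N M : ℕ} (pr : (Fin N → X) → Z → ℝ)
    (w : (Fin N → X) × (Fin M → Z)) :
    (ramMC f p q pr w).toReal = 1 / (M : ℝ) * ∑ m,
      f (mixture (fun x z => q x z / p z) w.1 (w.2 m)) * (p (w.2 m) / pr w.1 (w.2 m)) := by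
  have hm : ∀ z, 0 ≤ mixture (fun x z => q x z / p z) w.1 z := fun z =>
    mul_nonneg (by positivity) (Finset.sum_nonneg fun i _ => h0 _ z)
  unfold ramMC
  simp only [mixture_div, hf.extendZero_eq (hm _), ← EReal.coe_mul, ereal_coe_sum,
    EReal.toReal_coe]

/-- Both proposals are treated at once through `hlaw` and `hwt`: the proposal has density `r₀ + r₁ *
t` with respect to the prior, and the importance weight is its reciprocal. -/
theorem varianceBound_of_ratioModel {f : ℝ → ℝ} (hf : RegularGenerator f) {ν : Measure X}
    [IsProbabilityMeasure ν] {μ : Measure Z} [SigmaFinite μ] {p : Z → ℝ} {q : X → Z → ℝ}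
    (hp : IsDensity μ p) {r₀ r₁ : ℝ}
    (h : RatioModel f ν (law μ p) (fun x z => q x z / p z) r₀ r₁) {ψ : ℕ → ℝ} {L : ℝ}
    (hL : 0 ≤ L) (hψ : ∀ N : ℕ, 2 ≤ N → 1 / (N : ℝ) ≤ L * ψ N ^ 2)
    {pr : (N : ℕ) → (Fin N → X) → Z → ℝ} (hprm : ∀ N, Measurable (Function.uncurry (pr N)))
    (hprd : ∀ N, 1 ≤ N → ∀ x, IsDensity μ (pr N x))
    (hlaw : ∀ N, 1 ≤ N → ∀ᵐ x ∂(sampleLaw ν N), law μ (pr N x) = (law μ p).withDensity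
      fun z => ENNReal.ofReal (r₀ + r₁ * mixture (fun x z => q x z / p z) x z))
    (hwt : ∀ N, 1 ≤ N → ∀ x, ∀ᵐ z ∂(law μ p),
      p z / pr N x z = 1 / (r₀ + r₁ * mixture (fun x z => q x z / p z) x z)) :
    VarianceBound f ψ ν μ p q pr := by
  have := hp.isProbabilityMeasure_law
  obtain ⟨K₁, hK₁, hmom⟩ := h.exists_lintegral_growth_mixture_le hf
  obtain ⟨K₂, hK₂, hvar⟩ := h.variance_integral_mixture_le hf
  refine ⟨K₁ + K₂ * L, fun N M hN hM => ?_⟩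
  have hN1 : 1 ≤ N := by omega
  set s : X → Z → ℝ := fun x z => q x z / p z
  set H : (Fin N → X) → Z → ℝ := fun x z => f (mixture s x z) * (p z / pr N x z) with hH
  have hHm : Measurable (Function.uncurry H) := by
    have hpm : Measurable fun w : (Fin N → X) × Z => p w.2 := hp.measurable.comp measurable_snd
    exact Measurable.mul (h.measurable_comp_mixture hf N) (Measurable.div hpm (hprm N))
  have hHx : ∀ x, Measurable (H x) := fun x => hHm.of_uncurry_left
  have hfx : ∀ x : Fin N → X, Measurable fun z => f (mixture s x z) := fun x =>
    (h.measurable_comp_mixture hf N).of_uncurry_left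
  have hrx : ∀ x : Fin N → X, Measurable fun z => r₀ + r₁ * mixture s x z := fun x =>
    measurable_const.add ((measurable_mixture h.measurable N).of_uncurry_left.const_mul r₁)
  -- Under the proposal, the squared importance weight cancels against the density once, leaving
  -- `f(t) ^ 2 / (r₀ + r₁ * t)` under the prior, at most the growth moment.
  have hHK : ∫⁻ x, ∫⁻ z, ENNReal.ofReal (H x z ^ 2) ∂(law μ (pr N x)) ∂(sampleLaw ν N)
      ≤ ENNReal.ofReal K₁ := by
    refine le_trans (lintegral_mono_ae ?_) (hmom N hN1)
    filter_upwards [hlaw N hN1, h.ae_pos (N := N)] with x hx hr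
    rw [hx, lintegral_withDensity_eq_lintegral_mul _ (hrx x).ennreal_ofReal
      ((hHx x).pow_const 2).ennreal_ofReal]
    refine lintegral_mono_ae ?_
    filter_upwards [hr, hwt N hN1 x] with z hz hw
    have hrz : 0 < r₀ + r₁ * mixture s x z := weight_mixture_pos hN1 hz
    rw [Pi.mul_apply, ← ENNReal.ofReal_mul hrz.le]
    refine ENNReal.ofReal_le_ofReal ?_
    simp only [hH]
    rw [hw, le_div_iff₀ hrz]
    have e : (r₀ + r₁ * mixture s x z) * (f (mixture s x z) *
        (1 / (r₀ + r₁ * mixture s x z))) ^ 2 * (r₀ + r₁ * mixture s x z)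
        = f (mixture s x z) ^ 2 := by field_simp
    rw [e, growth]
    linarith [sq_nonneg (mixture s x z)]
  have hD : ∀ᵐ x ∂(sampleLaw ν N),
      ∫ z, f (mixture s x z) ∂(law μ p) = ∫ z, H x z ∂(law μ (pr N x)) := by
    filter_upwards [hlaw N hN1, h.ae_pos (N := N)] with x hx hr
    rw [hx, integral_withDensity_eq_integral_toReal_smul (hrx x).ennreal_ofReal
      (ae_of_all _ fun _ => ENNReal.ofReal_lt_top)]
    refine integral_congr_ae ?_
    filter_upwards [hr, hwt N hN1 x] with z hz hw
    have hrz : 0 < r₀ + r₁ * mixture s x z := weight_mixture_pos hN1 hz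
    simp only [hH]
    rw [hw, ENNReal.toReal_ofReal hrz.le, smul_eq_mul]
    field_simp
  have hDm : Measurable fun x : Fin N → X => ∫ z, f (mixture s x z) ∂(law μ p) :=
    (h.measurable_comp_mixture hf N).stronglyMeasurable.integral_prod_right.measurable
  obtain ⟨hT2, hD2, hle⟩ := variance_average_le ν μ hM (hprm N) (hprd N hN1) hHm hK₁ hHK hDm hD
  have hEq : (fun w : (Fin N → X) × (Fin M → Z) => (ramMC f p q (pr N) w).toReal)
      = fun w => 1 / (M : ℝ) * ∑ m, H w.1 (w.2 m) := by
    funext w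
    exact toReal_ramMC hf h.nonneg (pr N) w
  rw [hEq]
  refine ⟨hT2, hle.trans ?_⟩
  have h1 := hvar N hN1 hD2
  have h2 := mul_le_mul_of_nonneg_left (hψ N hN) hK₂
  have h3 : 0 ≤ K₁ * ψ N ^ 2 := by positivity
  have h4 : 0 ≤ K₂ * L * (1 / (M : ℝ)) := by positivity
  linarith

theorem eLpNorm_two_sq {Ω : Type*} [MeasurableSpace Ω] (τ : Measure Ω) (g : Ω → ℝ) :
    eLpNorm g 2 τ ^ 2 = ∫⁻ w, ENNReal.ofReal (g w ^ 2) ∂τ := by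
  have h := eLpNorm_nnreal_pow_eq_lintegral (f := g) (μ := τ) (p := 2) two_ne_zero
  simp only [NNReal.coe_ofNat, ENNReal.coe_ofNat, ENNReal.rpow_ofNat] at h
  rw [h]
  refine lintegral_congr fun w => ?_
  rw [← enorm_pow, Real.enorm_of_nonneg (sq_nonneg _)]

/-! ### The two moment hypotheses as ratio models. -/

section Models

variable {f : ℝ → ℝ} {ν : Measure X} {μ : Measure Z} {p : Z → ℝ} {q : X → Z → ℝ}

theorem lintegral_ratio_eq_one (hp : IsDensity μ p) (hqd : ∀ x, IsDensity μ (q x))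
    (hac : ∀ᵐ x ∂ν, ∀ᵐ z ∂μ, p z = 0 → q x z = 0) :
    ∀ᵐ x ∂ν, ∫⁻ z, ENNReal.ofReal (q x z / p z) ∂(law μ p) = 1 := by
  filter_upwards [hac] with x hx
  have hpm := hp.measurable
  have hqm := (hqd x).measurable
  rw [lintegral_law hpm (by fun_prop), ← (hqd x).lintegral_eq_one]
  refine lintegral_congr_ae ?_
  filter_upwards [hx] with z hz
  rw [← ENNReal.ofReal_mul (hp.nonneg z)]
  by_cases h0 : p z = 0
  · simp [h0, hz h0]
  · rw [mul_div_cancel₀ _ h0]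

theorem ae_law_pos (hp : IsDensity μ p) : ∀ᵐ z ∂(law μ p), 0 < p z := by
  rw [law, ae_withDensity_iff hp.measurable.ennreal_ofReal]
  exact ae_of_all _ fun z hz => by simpa using hz

theorem PriorMoments.ratioModel [SFinite μ] (hf : RegularGenerator f) (hp : IsDensity μ p)
    (hq : Measurable (Function.uncurry q)) (hqd : ∀ x, IsDensity μ (q x))
    (hac : ∀ᵐ x ∂ν, ∀ᵐ z ∂μ, p z = 0 → q x z = 0) [IsProbabilityMeasure ν]
    (h : PriorMoments f ν μ p q) :
    RatioModel f ν (law μ p) (fun x z => q x z / p z) 1 0 := by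
  have hprob := hp.isProbabilityMeasure_law
  have hpm : Measurable fun w : X × Z => p w.2 := hp.measurable.comp measurable_snd
  have hsm : Measurable (Function.uncurry fun x z => q x z / p z) := Measurable.div hq hpm
  have hs0 : ∀ x z, 0 ≤ q x z / p z := fun x z => div_nonneg ((hqd x).nonneg z) (hp.nonneg z)
  have hfm : Measurable (Function.uncurry fun x z => f (q x z / p z)) :=
    hf.measurable_comp hsm fun w => hs0 w.1 w.2
  have hsx : ∀ x, Measurable fun z => q x z / p z := fun x => hsm.of_uncurry_left
  have hfx : ∀ x, Measurable fun z => f (q x z / p z) := fun x => hfm.of_uncurry_left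
  refine ⟨hsm, hs0, lintegral_ratio_eq_one hp hqd hac, le_rfl, zero_le_one, by simp, ?_⟩
  have h1 := h.ratio
  have h2 := h.gen_ratio
  simp only [eLpNorm_two_sq] at h1
  simp only [eLpNorm_two_sq] at h2
  have e : ∀ x, ∫⁻ z, ENNReal.ofReal (growth f (q x z / p z) / (1 + 0 * (q x z / p z))) ∂(law μ p)
      = 1 + ∫⁻ z, ENNReal.ofReal ((q x z / p z) ^ 2) ∂(law μ p)
        + ∫⁻ z, ENNReal.ofReal (f (q x z / p z) ^ 2) ∂(law μ p) := by
    intro x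
    have e1 : ∀ z, ENNReal.ofReal (growth f (q x z / p z) / (1 + 0 * (q x z / p z)))
        = 1 + ENNReal.ofReal ((q x z / p z) ^ 2) + ENNReal.ofReal (f (q x z / p z) ^ 2) := by
      intro z
      rw [zero_mul, add_zero, div_one, growth, ENNReal.ofReal_add (by positivity) (sq_nonneg _),
        ENNReal.ofReal_add zero_le_one (sq_nonneg _), ENNReal.ofReal_one]
    rw [lintegral_congr e1, lintegral_add_right _ ((hfx x).pow_const 2).ennreal_ofReal,
      lintegral_add_right _ ((hsx x).pow_const 2).ennreal_ofReal, lintegral_one, measure_univ]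
  have hI1 : Measurable fun x => ∫⁻ z, ENNReal.ofReal ((q x z / p z) ^ 2) ∂(law μ p) :=
    Measurable.lintegral_prod_right' (hsm.pow_const 2).ennreal_ofReal
  have hI2 : Measurable fun x => ∫⁻ z, ENNReal.ofReal (f (q x z / p z) ^ 2) ∂(law μ p) :=
    Measurable.lintegral_prod_right' (hfm.pow_const 2).ennreal_ofReal
  rw [lintegral_congr e, lintegral_add_right _ hI2, lintegral_add_right _ hI1, lintegral_one,
    measure_univ]
  exact (ENNReal.add_lt_top.2 ⟨ENNReal.add_lt_top.2 ⟨ENNReal.one_lt_top, h1⟩, h2⟩).ne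

theorem MixtureMoments.ratioModel [SFinite μ] (hf : RegularGenerator f) (hp : IsDensity μ p)
    (hq : Measurable (Function.uncurry q)) (hqd : ∀ x, IsDensity μ (q x))
    (hac : ∀ᵐ x ∂ν, ∀ᵐ z ∂μ, p z = 0 → q x z = 0) [IsProbabilityMeasure ν]
    (h : MixtureMoments f ν μ p q) :
    RatioModel f ν (law μ p) (fun x z => q x z / p z) 0 1 := by
  have hprob := hp.isProbabilityMeasure_law
  have hpm : Measurable fun w : X × Z => p w.2 := hp.measurable.comp measurable_snd
  have hsm : Measurable (Function.uncurry fun x z => q x z / p z) := Measurable.div hq hpm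
  have hs0 : ∀ x z, 0 ≤ q x z / p z := fun x z => div_nonneg ((hqd x).nonneg z) (hp.nonneg z)
  have hfm : Measurable (Function.uncurry fun x z => f (q x z / p z)) :=
    hf.measurable_comp hsm fun w => hs0 w.1 w.2
  have him : Measurable (Function.uncurry fun x z => p z / q x z) := Measurable.div hpm hq
  have hgm : Measurable (Function.uncurry fun x z => f (q x z / p z) * (p z / q x z)) :=
    Measurable.mul hfm him
  have hix : ∀ x, Measurable fun z => p z / q x z := fun x => him.of_uncurry_left
  have hgx : ∀ x, Measurable fun z => f (q x z / p z) * (p z / q x z) := fun x =>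
    hgm.of_uncurry_left
  have hone := lintegral_ratio_eq_one hp hqd hac
  have hpos : ∀ᵐ x ∂ν, ∀ᵐ z ∂(law μ p), 0 < q x z / p z := by
    filter_upwards [h.pos] with x hx
    filter_upwards [hx, ae_law_pos hp] with z hz hpz
    exact div_pos hz hpz
  refine ⟨hsm, hs0, hone, zero_le_one, le_rfl, by simpa using hpos, ?_⟩
  have h1 := h.ratio
  have h2 := h.gen_ratio
  simp only [eLpNorm_two_sq] at h1
  simp only [eLpNorm_two_sq] at h2
  have hlaw : ∀ x, ∀ g : Z → ℝ, Measurable g →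
      ∫⁻ z, ENNReal.ofReal (g z ^ 2) ∂(law μ (q x))
        = ∫⁻ z, ENNReal.ofReal (q x z) * ENNReal.ofReal (g z ^ 2) ∂μ := fun x g hg =>
    lintegral_law (hqd x).measurable (hg.pow_const 2).ennreal_ofReal
  have hI1 : Measurable fun x => ∫⁻ z, ENNReal.ofReal ((p z / q x z) ^ 2) ∂(law μ (q x)) := by
    simp only [hlaw _ _ (hix _)]
    exact Measurable.lintegral_prod_right'
      (f := fun w : X × Z => ENNReal.ofReal (q w.1 w.2) * ENNReal.ofReal ((p w.2 / q w.1 w.2) ^ 2))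
      (hq.ennreal_ofReal.mul (him.pow_const 2).ennreal_ofReal)
  -- With `t = q / p`, integrating `1 / t`, `t` and `f(t) ^ 2 / t` under `p` gives `∫ p² / q`, the
  -- total mass one and `∫ f(t)² p² / q`: the two hypotheses and a constant. Where `p` or `q`
  -- vanishes, the convention for division by zero keeps the inequality true.
  have hbound : ∀ᵐ x ∂ν,
      ∫⁻ z, ENNReal.ofReal (growth f (q x z / p z) / (0 + 1 * (q x z / p z))) ∂(law μ p)
      ≤ 1 + ∫⁻ z, ENNReal.ofReal ((p z / q x z) ^ 2) ∂(law μ (q x))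
        + ∫⁻ z, ENNReal.ofReal ((f (q x z / p z) * (p z / q x z)) ^ 2) ∂(law μ (q x)) := by
    filter_upwards [hone] with x hx
    have hqm := (hqd x).measurable
    have hpm' := hp.measurable
    have hfx : Measurable fun z => f (q x z / p z) := hfm.of_uncurry_left
    have hgr : Measurable fun z => growth f (q x z / p z) :=
      (measurable_const.add ((hqm.div hpm').pow_const 2)).add (hfx.pow_const 2)
    rw [hlaw x _ (hix x), hlaw x _ (hgx x), ← hx, lintegral_law hpm' (by fun_prop),
      lintegral_law hpm' (by fun_prop),
      ← lintegral_add_right _ (by fun_prop), ← lintegral_add_right _ (by fun_prop)]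
    refine lintegral_mono fun z => ?_
    have hp0 := hp.nonneg z
    have hq0 := (hqd x).nonneg z
    rw [← ENNReal.ofReal_mul hp0, ← ENNReal.ofReal_mul hp0, ← ENNReal.ofReal_mul hq0,
      ← ENNReal.ofReal_mul hq0, ← ENNReal.ofReal_add (by positivity) (by positivity),
      ← ENNReal.ofReal_add (by positivity) (by positivity)]
    refine ENNReal.ofReal_le_ofReal ?_
    rw [growth, zero_add, one_mul]
    rcases hp0.eq_or_lt' with hp1 | hp1
    · simp [hp1]
    rcases hq0.eq_or_lt' with hq1 | hq1
    · simp [hq1]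
    · refine le_of_eq ?_
      field_simp
      ring
  refine ne_top_of_le_ne_top ?_ (lintegral_mono_ae hbound)
  have hI1' : Measurable fun x =>
      1 + ∫⁻ z, ENNReal.ofReal ((p z / q x z) ^ 2) ∂(law μ (q x)) := measurable_const.add hI1
  rw [lintegral_add_left hI1', lintegral_add_right _ hI1, lintegral_one,
    measure_univ]
  exact (ENNReal.add_lt_top.2 ⟨ENNReal.add_lt_top.2 ⟨ENNReal.one_lt_top, h1⟩, h2⟩).ne

/-- Absolute continuity of every sampled component is needed for the mixture to have no mass on `p =
0`, so the identity holds for almost every sample only. -/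
theorem law_mixture_eq_withDensity (hp : IsDensity μ p) (hqd : ∀ x, IsDensity μ (q x))
    (hac : ∀ᵐ x ∂ν, ∀ᵐ z ∂μ, p z = 0 → q x z = 0) [IsProbabilityMeasure ν] (N : ℕ) :
    ∀ᵐ x ∂(sampleLaw ν N), law μ (mixture q x)
      = (law μ p).withDensity fun z => ENNReal.ofReal (mixture q x z / p z) := by
  filter_upwards [ae_sampleLaw_of_ae hac] with x hx
  have hpm := hp.measurable
  have hm : Measurable (mixture q x) := by
    have : ∀ i, Measurable (q (x i)) := fun i => (hqd (x i)).measurable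
    unfold mixture
    fun_prop
  rw [law, law, ← withDensity_mul _ (by fun_prop) (by fun_prop)]
  refine withDensity_congr_ae ?_
  filter_upwards [ae_all_iff.2 hx] with z hz
  rw [Pi.mul_apply, ← ENNReal.ofReal_mul (hp.nonneg z)]
  by_cases h0 : p z = 0
  · simp [mixture, h0, hz _ h0]
  · rw [mul_div_cancel₀ _ h0]

end Models

end Assembly

end RAM

theorem theorem4 {X Z : Type*} [MeasurableSpace X] [MeasurableSpace Z]
    (ν : Measure X) [IsProbabilityMeasure ν] (μ : Measure Z) [SigmaFinite μ]
    (p : Z → ℝ) (q : X → Z → ℝ)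
    (hp : RAM.IsDensity μ p)
    (hq : Measurable (Function.uncurry q)) (hqd : ∀ x, RAM.IsDensity μ (q x))
    (hac : ∀ᵐ x ∂ν, ∀ᵐ z ∂μ, p z = 0 → q x z = 0) :
    (∀ f : ℝ → ℝ, ConvexOn ℝ (Ioi 0) f → f 1 = 0 →
      ∀ N M : ℕ, 1 ≤ N → 1 ≤ M →
      ∀ pr : (Fin N → X) → Z → ℝ, RAM.IsProposal f ν μ p q pr →
        RAM.negPart (RAM.jointLaw ν μ pr M) (RAM.ramMC f p q pr) ≠ ⊤ ∧
        RAM.negPart (RAM.sampleLaw ν N) (RAM.ram f μ p q) ≠ ⊤ ∧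
        RAM.expect (RAM.jointLaw ν μ pr M) (RAM.ramMC f p q pr)
          = RAM.expect (RAM.sampleLaw ν N) (RAM.ram f μ p q)) ∧
    (∀ D : RAM.Divergence, D.Admissible → ∀ c : ℝ,
      (RAM.PriorMoments (D.gen c) ν μ p q →
        RAM.VarianceBound (D.gen c) D.rate ν μ p q (fun _ _ z => p z)) ∧
      (RAM.MixtureMoments (D.gen c) ν μ p q →
        RAM.VarianceBound (D.gen c) D.rate ν μ p q (fun _ x z => RAM.mixture q x z))) := by
  refine ⟨fun f hf h1 N M hN hM pr hpr =>
    RAM.expect_ramMC_eq ν μ hp hq hqd hf h1 hN hM hpr, fun D hD c => ?_⟩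
  have hf := RAM.Divergence.regularGenerator_gen hD c
  have hL : (0 : ℝ) ≤ 1 + 1 / Real.log 2 ^ 2 := by positivity
  refine ⟨fun h => ?_, fun h => ?_⟩
  · refine RAM.varianceBound_of_ratioModel hf hp (h.ratioModel hf hp hq hqd hac) hL
      (fun N hN => RAM.Divergence.inv_le_mul_rate_sq hD hN)
      (fun N => hp.measurable.comp measurable_snd) (fun N _ x => hp)
      (fun N _ => ae_of_all _ fun x => ?_) fun N _ x => ?_
    · simp
    · filter_upwards [RAM.ae_law_pos hp] with z hz
      rw [div_self hz.ne']
      simp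
  · refine RAM.varianceBound_of_ratioModel hf hp (h.ratioModel hf hp hq hqd hac) hL
      (fun N hN => RAM.Divergence.inv_le_mul_rate_sq hD hN)
      (fun N => RAM.measurable_mixture hq N) (fun N hN x => RAM.isDensity_mixture hqd hN x)
      (fun N _ => ?_) fun N _ x => ae_of_all _ fun z => ?_
    · filter_upwards [RAM.law_mixture_eq_withDensity hp hqd hac N] with x hx
      simpa only [zero_add, one_mul, RAM.mixture_div] using hx
    · rw [zero_add, one_mul, ← RAM.mixture_div, one_div_div]
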